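/- Let $d\ge 1$ and $-d<\gamma\le 1$. Let $b_0:[-1,1]\to[0,\infty)$ be measurable with $0\le b_0(c)\le C_0|c|$ for some constant $C_0$, and put $B(z,\omega)=|z|^\gamma b_0(\omega\cdot z/|z|)$ for $z\in\mathbb R^d$, $\omega\in\mathbb S^{d-1}$, $$Q(F,G)(v)=\int_{\mathbb R^d}\int_{\mathbb S^{d-1}}B(v-v_*,\omega)\,\bigl(F(v_*')G(v')-F(v_*)G(v)\bigr)\,d\omega\,dv_*,$$ where $v'=v-((v-v_*)\cdot\omega)\,\omega$ and $v_*'=v_*+((v-v_*)\cdot\omega)\,\omega$. Let $M(v)=(2\pi)^{-d/2}e^{-|v|^2/2}$ and, for functions $f,g$ of $(x,v)\in\mathbb R^d\times\mathbb R^d$, let $\Gamma(f,g)=M^{-1/2}Q(M^{1/2}f,M^{1/2}g)$, where $Q$ acts in $v$ for fixed $x$. Fix radial functions $\chi\in C_0^\infty(\{|\xi|<4/3\})$ and $\phi\in C_0^\infty(\{3/4<|\xi|<8/3\})$ with values in $[0,1]$, such that $\chi(\xi)+\sum_{j\ge0}\phi(2^{-j}\xi)=1$ for all $\xi$ and $\sum_{j\in\mathbb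 Z}\phi(2^{-j}\xi)=1$ for all $\xi\ne0$. Let $\Delta_{-1}=\chi(D)$ and $\Delta_j=\phi(2^{-j}D)$ for $j\ge0$, acting in $x$. With $\langle v\rangle=(1+|v|^2)^{1/2}$ put $$\|f\|_{\tilde L^2_v(B^s_{2,1})}=\sum_{j\ge-1}2^{js}\|\Delta_jf\|_{L^2_vL^2_x},\qquad \|f\|_{\tilde L^\infty_\beta(B^s_{2,1})}=\sum_{j\ge-1}2^{js}\,\operatorname*{ess\,sup}_{v}\,\langle v\rangle^\beta\|\Delta_jf(\cdot,v)\|_{L^2_x},$$ and let $\tilde L^2_v(B^s_{2,1})$ and $\tilde L^\infty_\beta(B^s_{2,1})$ be the spaces of those $f$ for which these norms are finite. (For $s>0$ their elements are measurable functions of $(x,v)$, up to equality almost everywhere.) Assume $s\ge d/2$, $\beta>\gamma+d/2$ and $\beta\ge0$ (the last condition follows from the second if $\gamma\ge -d/2$, in particular for hard potentials $0\le\gamma\le1$). Then there is a constant $C>0$, independent of $f$ and $g$, such that for all $f,g\in\tilde L^\infty_\beta(B^s_{2,1})$ the integral defining $\Gamma(f,g)(x,v)$ converges absolutely for almost every $(x,v)$,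 $\Gamma(f,g)\in\tilde L^2_v(B^s_{2,1})$, and $$\|\Gamma(f,g)\|_{\tilde L^2_v(B^s_{2,1})}\le C\,\|f\|_{\tilde L^\infty_\beta(B^s_{2,1})}\,\|g\|_{\tilde L^\infty_\beta(B^s_{2,1})}.$$ -/

import Mathlib

open MeasureTheory Set Function
open scoped ENNReal SchwartzMap

noncomputable section

namespace Boltzmann

/-- The space `ℝ^d` with its Euclidean norm; both the position `x` and the velocity `v` live here. -/
abbrev Space (d : ℕ) := EuclideanSpace ℝ (Fin d)

/-! ### Littlewood-Paley decomposition in the position variable -/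

/-- A pair of radial cutoff functions generating the (inhomogeneous) Littlewood-Paley
decomposition of `ℝ^d`. -/
structure LittlewoodPaley (d : ℕ) where
  /-- low-frequency cutoff -/
  chi : Space d → ℝ
  /-- annular cutoff -/
  phi : Space d → ℝ
  chi_radial : ∀ ξ η : Space d, ‖ξ‖ = ‖η‖ → chi ξ = chi η
  phi_radial : ∀ ξ η : Space d, ‖ξ‖ = ‖η‖ → phi ξ = phi η
  chi_smooth : ContDiff ℝ (⊤ : ℕ∞) chi
  phi_smooth : ContDiff ℝ (⊤ : ℕ∞) phi
  chi_supp : tsupport chi ⊆ {ξ | ‖ξ‖ < 4 / 3}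
  phi_supp : tsupport phi ⊆ {ξ | 3 / 4 < ‖ξ‖ ∧ ‖ξ‖ < 8 / 3}
  chi_mem : ∀ ξ, chi ξ ∈ Icc (0 : ℝ) 1
  phi_mem : ∀ ξ, phi ξ ∈ Icc (0 : ℝ) 1
  /-- `χ(ξ) + ∑_{j ≥ 0} φ(2^{-j} ξ) = 1` for every `ξ` -/
  partition_inhom : ∀ ξ, HasSum (fun j : ℕ => phi ((2 : ℝ) ^ (-(j : ℤ)) • ξ)) (1 - chi ξ)
  /-- `∑_{j ∈ ℤ} φ(2^{-j} ξ) = 1` for every `ξ ≠ 0` -/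
  partition_hom : ∀ ξ, ξ ≠ 0 → HasSum (fun j : ℤ => phi ((2 : ℝ) ^ (-j) • ξ)) 1
  phi_phi_disjoint : ∀ i j : ℤ, 2 ≤ |i - j| →
    Disjoint (tsupport fun ξ => phi ((2 : ℝ) ^ (-i) • ξ))
      (tsupport fun ξ => phi ((2 : ℝ) ^ (-j) • ξ))
  chi_phi_disjoint : ∀ j : ℤ, 1 ≤ j →
    Disjoint (tsupport chi) (tsupport fun ξ => phi ((2 : ℝ) ^ (-j) • ξ))

variable {d : ℕ}

/-- The symbol of `Δ_j`: `χ` for `j = -1` and `φ(2^{-j} ·)` for `j ≥ 0`. The value for `j < -1` is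
never used. -/
def LittlewoodPaley.symbol (L : LittlewoodPaley d) (j : ℤ) (ξ : Space d) : ℝ :=
  if j = -1 then L.chi ξ else L.phi ((2 : ℝ) ^ (-j) • ξ)

/-- The dyadic block `Δ_j u` of a tempered distribution, that is `χ(D) u` or `φ(2^{-j} D) u` with
`D = -i∇`. Mathlib's Fourier transform has the kernel `e^{-2πi x·ξ}`, so that `D` is
multiplication by `2πξ` on the Fourier side. -/
def LittlewoodPaley.block (L : LittlewoodPaley d) (j : ℤ) : 𝓢'(Space d, ℂ) →L[ℂ] 𝓢'(Space d, ℂ) :=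
  TemperedDistribution.fourierMultiplierCLM ℂ
    (fun ξ : Space d => ((L.symbol j ((2 * Real.pi) • ξ) : ℝ) : ℂ))

/-- The `L²` norm of a tempered distribution; it is `∞` if the distribution is not (given by) an
`L²` function. -/
def l2Norm (u : 𝓢'(Space d, ℂ)) : ℝ≥0∞ :=
  ⨅ (w : Lp ℂ 2 (volume : Measure (Space d))) (_ : (w : 𝓢'(Space d, ℂ)) = u), ‖w‖ₑ

/-- The tempered distribution `u` is the (regular) distribution given by the function `h`. -/
def IsRegular (u : 𝓢'(Space d, ℂ)) (h : Space d → ℂ) : Prop :=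
  AEStronglyMeasurable h volume ∧
    ∀ ψ : 𝓢(Space d, ℂ), Integrable (fun x => ψ x • h x) ∧ u ψ = ∫ x, ψ x • h x

/-- `‖Δ_j h‖_{L²}` for a function `h` on `ℝ^d`, which is regarded as a tempered distribution `u`
(this `u` is unique). The value is `∞` if `h` is not a tempered distribution or if `Δ_j h` is not
square integrable. -/
def LittlewoodPaley.blockNorm (L : LittlewoodPaley d) (j : ℤ) (h : Space d → ℂ) : ℝ≥0∞ :=
  ⨅ (u : 𝓢'(Space d, ℂ)) (_ : IsRegular u h), l2Norm (L.block j u)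

/-- The weighted sum `∑_{j ≥ -1} 2^{js} a_j`. -/
def dyadicSum (s : ℝ) (a : ℤ → ℝ≥0∞) : ℝ≥0∞ :=
  ENNReal.ofReal ((2 : ℝ) ^ (-s)) * a (-1) +
    ∑' j : ℕ, ENNReal.ofReal ((2 : ℝ) ^ ((j : ℝ) * s)) * a (j : ℤ)

/-! ### Chemin-Lerner spaces of functions `f = f(x, v)` -/

/-- The Japanese bracket `⟨v⟩ = (1 + |v|²)^{1/2}`. -/
def bracket (v : Space d) : ℝ := Real.sqrt (1 + ‖v‖ ^ 2)

/-- `∑_{j ≥ -1} 2^{js} ‖Δ_j f‖_{L²_v L²_x}`. -/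
def LittlewoodPaley.normL2 (L : LittlewoodPaley d) (s : ℝ) (f : Space d → Space d → ℂ) : ℝ≥0∞ :=
  dyadicSum s fun j => (∫⁻ v, L.blockNorm j (fun x => f x v) ^ (2 : ℝ)) ^ (1 / 2 : ℝ)

/-- `∑_{j ≥ -1} 2^{js} sup_v ⟨v⟩^β ‖Δ_j f(·, v)‖_{L²_x}`, with the essential supremum. -/
def LittlewoodPaley.normLinfty (L : LittlewoodPaley d) (s β : ℝ) (f : Space d → Space d → ℂ) :
    ℝ≥0∞ :=
  dyadicSum s fun j =>
    essSup (fun v => ENNReal.ofReal (bracket v ^ β) * L.blockNorm j (fun x => f x v)) volume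

/-- Membership in the Chemin-Lerner space `L̃²_v(B^s_{2,1})`. -/
def LittlewoodPaley.MemL2 (L : LittlewoodPaley d) (s : ℝ) (f : Space d → Space d → ℂ) : Prop :=
  AEStronglyMeasurable (uncurry f) (volume.prod volume) ∧ L.normL2 s f < ∞

/-- Membership in the velocity-weighted Chemin-Lerner space `L̃^∞_β(B^s_{2,1})`. -/
def LittlewoodPaley.MemLinfty (L : LittlewoodPaley d) (s β : ℝ) (f : Space d → Space d → ℂ) :
    Prop :=
  AEStronglyMeasurable (uncurry f) (volume.prod volume) ∧ L.normLinfty s β f < ∞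

/-! ### The collision operator -/

/-- The unit sphere `𝕊^{d-1}`. -/
abbrev Sphere (d : ℕ) := Metric.sphere (0 : Space d) 1

/-- The surface measure `dω` on `𝕊^{d-1}` (the counting measure on `{-1, 1}` if `d = 1`). -/
def surfaceMeasure (d : ℕ) : Measure (Sphere d) := (volume : Measure (Space d)).toSphere

/-- `v' = v - ((v - v_*)·ω) ω`. -/
def vPrime (v vs : Space d) (ω : Sphere d) : Space d :=
  v - (inner ℝ (v - vs) (ω : Space d)) • (ω : Space d)

/-- `v'_* = v_* + ((v - v_*)·ω) ω`. -/
def vsPrime (v vs : Space d) (ω : Sphere d) : Space d :=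
  vs + (inner ℝ (v - vs) (ω : Space d)) • (ω : Space d)

/-- The collision kernel `B(z, ω) = |z|^γ b₀(cos θ)`, `cos θ = ω·z/|z|`. -/
def kernel (γ : ℝ) (b₀ : ℝ → ℝ) (z : Space d) (ω : Sphere d) : ℝ :=
  ‖z‖ ^ γ * b₀ (inner ℝ (ω : Space d) z / ‖z‖)

/-- The integrand `B(v - v_*, ω) (F'_* G' - F_* G)` as a function of `(v_*, ω)`. -/
def collisionIntegrand (γ : ℝ) (b₀ : ℝ → ℝ) (F G : Space d → ℂ) (v : Space d)
    (p : Space d × Sphere d) : ℂ :=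
  (kernel γ b₀ (v - p.1) p.2 : ℂ) *
    (F (vsPrime v p.1 p.2) * G (vPrime v p.1 p.2) - F p.1 * G v)

/-- The collision operator `Q(F, G)(v) = ∫∫ B(v - v_*, ω) (F'_* G' - F_* G) dω dv_*`. -/
def collisionQ (γ : ℝ) (b₀ : ℝ → ℝ) (F G : Space d → ℂ) (v : Space d) : ℂ :=
  ∫ p, collisionIntegrand γ b₀ F G v p ∂((volume : Measure (Space d)).prod (surfaceMeasure d))

/-- The global Maxwellian `M(v) = (2π)^{-d/2} e^{-|v|²/2}`. -/
def maxwellian (v : Space d) : ℝ :=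
  (1 / (2 * Real.pi) ^ ((d : ℝ) / 2)) * Real.exp (-‖v‖ ^ 2 / 2)

/-- The function `M^{1/2} f(x, ·)` of the velocity. -/
def sqrtMaxwellianMul (f : Space d → Space d → ℂ) (x v : Space d) : ℂ :=
  ((maxwellian v ^ (1 / 2 : ℝ) : ℝ) : ℂ) * f x v

/-- The nonlinear collision term `Γ(f, g) = M^{-1/2} Q(M^{1/2} f, M^{1/2} g)`. -/
def Gamma (γ : ℝ) (b₀ : ℝ → ℝ) (f g : Space d → Space d → ℂ) (x v : Space d) : ℂ :=
  ((maxwellian v ^ (-(1 / 2) : ℝ) : ℝ) : ℂ) *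
    collisionQ γ b₀ (sqrtMaxwellianMul f x) (sqrtMaxwellianMul g x) v

/-- The integral that defines `Γ(f, g)(x, v)` converges absolutely for almost every `(x, v)`. -/
def GammaConverges (γ : ℝ) (b₀ : ℝ → ℝ) (f g : Space d → Space d → ℂ) : Prop :=
  ∀ᵐ q : Space d × Space d ∂(volume.prod volume),
    Integrable
      (collisionIntegrand γ b₀ (sqrtMaxwellianMul f q.1) (sqrtMaxwellianMul g q.1) q.2)
      ((volume : Measure (Space d)).prod (surfaceMeasure d))

end Boltzmann

end

/-!
The estimate separates into a product estimate in `x`, uniform in the velocities, and an integral in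
the velocities.

For the product estimate, a function `h` of `x` with `∑ 2^{nd/2} ‖Δ_n h‖_{L²} < ∞` is the inverse
Fourier transform of an integrable density, whose dyadic pieces have the norms `‖Δ_n h‖_{L²}`
(`LittlewoodPaley.exists_fourierDensity`). The product of two such functions is the inverse transform
of the convolution of their densities. Decompose both densities dyadically. A pair of pieces at the
frequencies `2^p` and `2^q` contributes to the block of frequency `2^j` only if `j ≤ max p q + 2`,
and Young's inequality, with the piece of lower frequency in `L¹` (Bernstein's inequality), bounds
its contribution by `2^{min(p, q) d/2}` times the product of the norms
(`LittlewoodPaley.enorm_integral_mul_block_le`). No paraproduct decomposition is needed: as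
`s ≥ d/2` and `s > 0`, the weight `2^{js}`, summed over `j ≤ max p q + 2`, together with this loss
is bounded by a multiple of `2^{ps} 2^{qs}` (`exists_dyadicSum_le`).

For the velocities, conservation of energy cancels the Maxwellians, so that `Γ(f, g)` is the integral
of `B(v - v_*, ω) M(v_*)^{1/2} (f'_* g' - f_* g)` (`Gamma_eq_integral`). By `β ≥ 0` and
`⟨v⟩ ≤ ⟨v'_*⟩ ⟨v'⟩`, the gain and the loss are both bounded by the weight `⟨v⟩^{-β}`, and
`∫∫ B M_*^{1/2} dω dv_* ≤ C ⟨v⟩^γ` because `γ > -d` (`exists_lintegral_collisionWeight_le`). The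
blocks of `Γ(f, g)(·, v)` are then bounded through duality and Fubini's theorem
(`LittlewoodPaley.blockNorm_integral_le`), and `⟨v⟩^{γ - β}` is square integrable as
`β > γ + d/2`. That `(v, v_*, ω) ↦ (v', v'_*, ω)` preserves the measure
(`measurePreserving_collisionMap`) ensures that bounds valid for almost every velocity may be used at
the velocities `v'` and `v'_*`.
-/

noncomputable section

namespace Boltzmann

open FourierTransform

variable {d : ℕ}

/-! ### The symbols of the dyadic blocks -/

/-- The symbol of `Δ_{n-1}` as a function of the frequency variable of Mathlib's Fourier transform.
The shift of the index makes the blocks a sequence indexed by `ℕ`. -/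
def LittlewoodPaley.sym (L : LittlewoodPaley d) (n : ℕ) (ξ : Space d) : ℝ :=
  L.symbol ((n : ℤ) - 1) ((2 * Real.pi) • ξ)

namespace LittlewoodPaley

variable (L : LittlewoodPaley d)

lemma sym_zero (ξ : Space d) : L.sym 0 ξ = L.chi ((2 * Real.pi) • ξ) := by
  simp [sym, symbol]

lemma sym_succ (n : ℕ) (ξ : Space d) :
    L.sym (n + 1) ξ = L.phi ((2 : ℝ) ^ (-(n : ℤ)) • (2 * Real.pi) • ξ) := by
  have h : ((n + 1 : ℕ) : ℤ) - 1 = n := by push_cast; ring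
  have h' : (n : ℤ) ≠ -1 := by omega
  simp only [sym, symbol, h, if_neg h']

lemma sym_mem (n : ℕ) (ξ : Space d) : L.sym n ξ ∈ Icc (0 : ℝ) 1 := by
  cases n with
  | zero => rw [sym_zero]; exact L.chi_mem _
  | succ n => rw [sym_succ]; exact L.phi_mem _

lemma sym_nonneg (n : ℕ) (ξ : Space d) : 0 ≤ L.sym n ξ := (L.sym_mem n ξ).1

lemma sym_le_one (n : ℕ) (ξ : Space d) : L.sym n ξ ≤ 1 := (L.sym_mem n ξ).2

lemma hasSum_sym (ξ : Space d) : HasSum (fun n => L.sym n ξ) 1 := by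
  rw [← hasSum_nat_add_iff' 1]
  simpa [sym_succ, sym_zero] using L.partition_inhom ((2 * Real.pi) • ξ)

/-- The low-frequency cutoff at scale `2^N` telescopes into dyadic blocks. -/
lemma sum_sym (N : ℕ) (ξ : Space d) :
    ∑ n ∈ Finset.range (N + 1), L.sym n ξ = L.sym 0 ((2 : ℝ) ^ (-(N : ℤ)) • ξ) := by
  have h1 := ((hasSum_nat_add_iff' (N + 1)).2 (L.hasSum_sym ξ))
  have h2 := ((hasSum_nat_add_iff' 1).2 (L.hasSum_sym ((2 : ℝ) ^ (-(N : ℤ)) • ξ)))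
  have h3 : (fun n => L.sym (n + (N + 1)) ξ) =
      fun n => L.sym (n + 1) ((2 : ℝ) ^ (-(N : ℤ)) • ξ) := by
    ext n
    rw [← add_assoc, sym_succ, sym_succ]
    congr 1
    rw [smul_smul, smul_smul, smul_smul]
    congr 1
    have : (2 : ℝ) ^ (-((n + N : ℕ) : ℤ)) = 2 ^ (-(n : ℤ)) * 2 ^ (-(N : ℤ)) := by
      rw [← zpow_add₀ two_ne_zero]; congr 1; push_cast; ring
    rw [this]; ring
  rw [h3] at h1
  simpa using h1.unique h2

lemma norm_lt_of_sym_ne_zero {n : ℕ} {ξ : Space d} (h : L.sym n ξ ≠ 0) :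
    2 * Real.pi * ‖ξ‖ < 4 / 3 * 2 ^ n := by
  have hpi : ‖(2 * Real.pi) • ξ‖ = 2 * Real.pi * ‖ξ‖ := by
    rw [norm_smul, Real.norm_of_nonneg (by positivity)]
  cases n with
  | zero =>
    rw [sym_zero] at h
    have := L.chi_supp (subset_tsupport _ h)
    rw [mem_ofPred_eq, hpi] at this
    simpa using this
  | succ n =>
    rw [sym_succ] at h
    have := (L.phi_supp (subset_tsupport _ h)).2
    rw [norm_smul, hpi, Real.norm_of_nonneg (by positivity), zpow_neg, zpow_natCast,
      inv_mul_lt_iff₀ (by positivity)] at this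
    rw [pow_succ]; linarith

lemma lt_norm_of_sym_succ_ne_zero {n : ℕ} {ξ : Space d} (h : L.sym (n + 1) ξ ≠ 0) :
    3 / 4 * 2 ^ n < 2 * Real.pi * ‖ξ‖ := by
  have hpi : ‖(2 * Real.pi) • ξ‖ = 2 * Real.pi * ‖ξ‖ := by
    rw [norm_smul, Real.norm_of_nonneg (by positivity)]
  rw [sym_succ] at h
  have := (L.phi_supp (subset_tsupport _ h)).1
  rw [norm_smul, hpi, Real.norm_of_nonneg (by positivity), zpow_neg, zpow_natCast,
    lt_inv_mul_iff₀ (by positivity)] at this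
  linarith

lemma norm_le_of_sym_ne_zero {n : ℕ} {ξ : Space d} (h : L.sym n ξ ≠ 0) : ‖ξ‖ ≤ 2 ^ n := by
  have h1 := L.norm_lt_of_sym_ne_zero h
  have h2 := Real.pi_gt_three
  have h3 := norm_nonneg ξ
  have h4 : (0 : ℝ) < 2 ^ n := by positivity
  nlinarith

/-- The frequencies of a product of two dyadic pieces are bounded by the larger scale. -/
lemma le_max_add_two {j p q : ℕ} {ξ η : Space d} (hj : L.sym j (ξ + η) ≠ 0)
    (hp : L.sym p ξ ≠ 0) (hq : L.sym q η ≠ 0) : j ≤ max p q + 2 := by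
  cases j with
  | zero => omega
  | succ n =>
    have h1 := L.lt_norm_of_sym_succ_ne_zero hj
    have h2 := L.norm_lt_of_sym_ne_zero hp
    have h3 := L.norm_lt_of_sym_ne_zero hq
    have h4 : 2 * Real.pi * ‖ξ + η‖ ≤ 2 * Real.pi * ‖ξ‖ + 2 * Real.pi * ‖η‖ := by
      rw [← mul_add]; exact mul_le_mul_of_nonneg_left (norm_add_le _ _) (by positivity)
    have h5 : (2 : ℝ) ^ p ≤ 2 ^ max p q := pow_le_pow_right₀ one_le_two (le_max_left _ _)
    have h6 : (2 : ℝ) ^ q ≤ 2 ^ max p q := pow_le_pow_right₀ one_le_two (le_max_right _ _)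
    have h7 : (2 : ℝ) ^ n < 2 ^ (max p q + 2) := by
      rw [pow_add]
      have : (0 : ℝ) < 2 ^ max p q := by positivity
      linarith
    have := (pow_lt_pow_iff_right₀ (one_lt_two : (1 : ℝ) < 2)).1 h7
    omega

lemma sym_zero_eq_one {ξ : Space d} (h : ‖ξ‖ ≤ 1 / 10) : L.sym 0 ξ = 1 := by
  have h1 : ∀ n, L.sym (n + 1) ξ = 0 := by
    intro n
    by_contra hn
    have h2 := L.lt_norm_of_sym_succ_ne_zero hn
    have h3 : (1 : ℝ) ≤ 2 ^ n := one_le_pow₀ one_le_two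
    have h4 := Real.pi_lt_d2
    have h5 := Real.pi_pos
    have := norm_nonneg ξ
    nlinarith
  have h2 := ((hasSum_nat_add_iff' 1).2 (L.hasSum_sym ξ))
  simp only [h1] at h2
  have := h2.unique hasSum_zero
  simp at this
  linarith

lemma contDiff_sym (n : ℕ) : ContDiff ℝ (⊤ : ℕ∞) (L.sym n) := by
  cases n with
  | zero =>
    rw [show L.sym 0 = fun ξ => L.chi ((2 * Real.pi) • ξ) from funext L.sym_zero]
    exact L.chi_smooth.comp (contDiff_const_smul _)
  | succ n =>
    rw [show L.sym (n + 1) = fun ξ => L.phi ((2 : ℝ) ^ (-(n : ℤ)) • (2 * Real.pi) • ξ) from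
      funext (L.sym_succ n)]
    exact L.phi_smooth.comp ((contDiff_const_smul _).comp (contDiff_const_smul _))

lemma hasCompactSupport_sym (n : ℕ) : HasCompactSupport (L.sym n) := by
  refine HasCompactSupport.intro (isCompact_closedBall (0 : Space d) (2 ^ n)) fun ξ hξ => ?_
  by_contra h
  exact hξ (by simpa using L.norm_le_of_sym_ne_zero h)

lemma continuous_sym (n : ℕ) : Continuous (L.sym n) := (L.contDiff_sym n).continuous

lemma hasTemperateGrowth_sym (n : ℕ) : (fun ξ => (L.sym n ξ : ℂ)).HasTemperateGrowth :=
  Complex.hasTemperateGrowth_ofReal.comp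
    ((L.hasCompactSupport_sym n).hasTemperateGrowth (L.contDiff_sym n))

end LittlewoodPaley

/-! ### Tempered distributions and square integrable functions -/

/-- The dual characterization of the `L²` norm, from Riesz' representation theorem and the density
of the Schwartz functions. -/
lemma l2Norm_le_of_forall {u : 𝓢'(Space d, ℂ)} {K : ℝ} (hK : 0 ≤ K)
    (h : ∀ ψ : 𝓢(Space d, ℂ), ‖u ψ‖ ≤ K * ‖ψ.toLp 2‖) : l2Norm u ≤ ENNReal.ofReal K := by
  have hd : DenseRange (SchwartzMap.toLpCLM ℂ (E := Space d) ℂ 2 volume) :=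
    SchwartzMap.denseRange_toLpCLM (by simp)
  -- the functional extends to `L²`, where it is represented by a function
  have hbd : ∀ ψ : 𝓢(Space d, ℂ), ‖(u : 𝓢(Space d, ℂ) →ₗ[ℂ] ℂ) ψ‖ ≤
      K * ‖(SchwartzMap.toLpCLM ℂ (E := Space d) ℂ 2 volume :
        𝓢(Space d, ℂ) →ₗ[ℂ] Lp ℂ 2 (volume : Measure (Space d))) ψ‖ := h
  let T : Lp ℂ 2 (volume : Measure (Space d)) →L[ℂ] ℂ :=
    LinearMap.extendOfNorm (u : 𝓢(Space d, ℂ) →ₗ[ℂ] ℂ)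
      (SchwartzMap.toLpCLM ℂ (E := Space d) ℂ 2 volume : 𝓢(Space d, ℂ) →ₗ[ℂ] _)
  have hT : ∀ ψ : 𝓢(Space d, ℂ), T (ψ.toLp 2) = u ψ :=
    LinearMap.extendOfNorm_eq hd ⟨K, hbd⟩
  have hTn : ‖T‖ ≤ K := LinearMap.opNorm_extendOfNorm_le hd hK hbd
  set w := (InnerProductSpace.toDual ℂ (Lp ℂ 2 (volume : Measure (Space d)))).symm T with hw
  have hwn : ‖w‖ ≤ K := by rw [hw, LinearIsometryEquiv.norm_map]; exact hTn
  have hwu : ((star w : Lp ℂ 2 (volume : Measure (Space d))) : 𝓢'(Space d, ℂ)) = u := by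
    ext ψ
    have hin : T (ψ.toLp 2) = inner ℂ w (ψ.toLp 2) :=
      InnerProductSpace.toDual_symm_apply.symm
    rw [Lp.toTemperedDistribution_apply, ← hT ψ, hin, L2.inner_def]
    refine integral_congr_ae ?_
    filter_upwards [ψ.coeFn_toLp 2 volume, Lp.coeFn_star w] with x h1 h2
    rw [h1, h2]
    simp
  refine (iInf₂_le (f := fun (w : Lp ℂ 2 (volume : Measure (Space d)))
    (_ : (w : 𝓢'(Space d, ℂ)) = u) => ‖w‖ₑ) _ hwu).trans ?_
  have hws : ‖star w‖ₑ = ‖w‖ₑ := by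
    rw [Lp.enorm_def, Lp.enorm_def]
    refine eLpNorm_congr_norm_ae ?_
    filter_upwards [Lp.coeFn_star w] with x hx
    rw [hx, Pi.star_apply, norm_star]
  rw [hws, ← ofReal_norm]
  exact ENNReal.ofReal_le_ofReal hwn

lemma toTemperedDistribution_injective :
    Injective (fun w : Lp ℂ 2 (volume : Measure (Space d)) => (w : 𝓢'(Space d, ℂ))) := by
  have h := LinearMap.ker_eq_bot.1 (Lp.ker_toTemperedDistributionCLM_eq_bot (F := ℂ)
    (μ := (volume : Measure (Space d))) (p := 2))
  exact h

lemma exists_eq_of_l2Norm_lt_top {u : 𝓢'(Space d, ℂ)} (h : l2Norm u < ∞) :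
    ∃ w : Lp ℂ 2 (volume : Measure (Space d)), (w : 𝓢'(Space d, ℂ)) = u ∧ ‖w‖ₑ = l2Norm u := by
  have : ∃ w : Lp ℂ 2 (volume : Measure (Space d)), (w : 𝓢'(Space d, ℂ)) = u := by
    by_contra! hn
    simp [l2Norm, hn] at h
  obtain ⟨w, hw⟩ := this
  refine ⟨w, hw, le_antisymm ?_ (iInf₂_le w hw)⟩
  refine le_iInf₂ fun w' hw' => ?_
  rw [toTemperedDistribution_injective (hw.trans hw'.symm)]

lemma IsRegular.blockNorm_eq {L : LittlewoodPaley d} {u : 𝓢'(Space d, ℂ)} {h : Space d → ℂ}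
    (hu : IsRegular u h) (j : ℤ) : L.blockNorm j h = l2Norm (L.block j u) := by
  refine le_antisymm (iInf₂_le u hu) (le_iInf₂ fun u' hu' => ?_)
  have : u' = u := by
    ext ψ
    rw [(hu.2 ψ).2, (hu'.2 ψ).2]
  rw [this]

lemma exists_isRegular_of_blockNorm_lt_top {L : LittlewoodPaley d} {j : ℤ} {h : Space d → ℂ}
    (hh : L.blockNorm j h < ∞) : ∃ u, IsRegular u h := by
  by_contra! hn
  simp [LittlewoodPaley.blockNorm, hn] at hh

/-- A function against which all Schwartz functions are integrable is locally integrable. -/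
lemma IsRegular.locallyIntegrable {u : 𝓢'(Space d, ℂ)} {h : Space d → ℂ}
    (hu : IsRegular u h) : LocallyIntegrable h := by
  rw [locallyIntegrable_iff]
  intro K hK
  obtain ⟨R, hR, hKR⟩ := hK.isBounded.subset_closedBall_lt 0 0
  let b : ContDiffBump (0 : Space d) := ⟨R, R + 1, hR, by linarith⟩
  have hc : HasCompactSupport (Complex.ofRealCLM ∘ b) := b.hasCompactSupport.comp_left rfl
  have hs : ContDiff ℝ (⊤ : ℕ∞) (Complex.ofRealCLM ∘ b) :=
    Complex.ofRealCLM.contDiff.comp b.contDiff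
  have hi := (hu.2 (hc.toSchwartzMap hs)).1
  refine (hi.integrableOn (s := K)).congr_fun (fun x hx => ?_) hK.measurableSet
  have : b x = 1 := b.one_of_mem_closedBall (hKR hx)
  simp [this]

/-- Two functions that define the same tempered distribution agree almost everywhere. -/
lemma IsRegular.ae_eq {u : 𝓢'(Space d, ℂ)} {h h' : Space d → ℂ} (hu : IsRegular u h)
    (hu' : IsRegular u h') : h =ᵐ[volume] h' := by
  refine ae_eq_of_integral_contDiff_smul_eq hu.locallyIntegrable hu'.locallyIntegrable
    fun g hg hgc => ?_
  have hc : HasCompactSupport (Complex.ofRealCLM ∘ g) := hgc.comp_left rfl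
  have hs : ContDiff ℝ (⊤ : ℕ∞) (Complex.ofRealCLM ∘ g) := Complex.ofRealCLM.contDiff.comp hg
  have := (hu.2 (hc.toSchwartzMap hs)).2.symm.trans (hu'.2 (hc.toSchwartzMap hs)).2
  simpa using this

/-! ### Smooth cutoffs converge in the Schwartz space -/

/-- If `Θ` is a smooth compactly supported function that equals `1` near the origin, then
`Θ(2^{-N} ·) ψ` converges to `ψ` in the Schwartz space. -/
lemma tendsto_cutoff_smul {Θ : Space d → ℝ} (hΘ : ContDiff ℝ (⊤ : ℕ∞) Θ)
    (hc : HasCompactSupport Θ) {r : ℝ} (hr : 0 < r) (h1 : ∀ ξ, ‖ξ‖ ≤ r → Θ ξ = 1)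
    (ψ : 𝓢(Space d, ℂ)) :
    Filter.Tendsto (fun N : ℕ => SchwartzMap.smulLeftCLM ℂ
      (fun ξ => (Θ ((2 : ℝ) ^ (-(N : ℤ)) • ξ) : ℂ)) ψ) Filter.atTop (nhds ψ) := by
  have htg : ∀ N : ℕ, (fun ξ => (Θ ((2 : ℝ) ^ (-(N : ℤ)) • ξ) : ℂ)).HasTemperateGrowth := by
    intro N
    refine Complex.hasTemperateGrowth_ofReal.comp ((hc.hasTemperateGrowth hΘ).comp ?_)
    exact (((2 : ℝ) ^ (-(N : ℤ))) • ContinuousLinearMap.id ℝ (Space d)).hasTemperateGrowth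
  rw [(schwartz_withSeminorms ℝ (Space d) ℂ).tendsto_nhds _ _]
  rintro ⟨k, m⟩ ε hε
  -- bounds for the derivatives of the complementary cutoff, uniform in the scale
  let G : Space d → ℂ := fun ξ => 1 - (Θ ξ : ℂ)
  have hΘc : ContDiff ℝ (⊤ : ℕ∞) (Complex.ofRealCLM ∘ Θ) := Complex.ofRealCLM.contDiff.comp hΘ
  have hGs : ContDiff ℝ (⊤ : ℕ∞) G := contDiff_const.sub hΘc
  have hGd : ∀ (N : ℕ) i ξ, iteratedFDeriv ℝ i (fun ξ => G ((2 : ℝ) ^ (-(N : ℤ)) • ξ)) ξ =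
      ((2 : ℝ) ^ (-(N : ℤ))) ^ i • iteratedFDeriv ℝ i G ((2 : ℝ) ^ (-(N : ℤ)) • ξ) := by
    intro N i ξ
    rw [iteratedFDeriv_comp_const_smul _ (hGs.of_le (by exact_mod_cast le_top))]
  have hG1 : ∀ i, ∃ C : ℝ, ∀ ξ, ‖iteratedFDeriv ℝ i G ξ‖ ≤ C := by
    intro i
    have hci : HasCompactSupport (iteratedFDeriv ℝ i (Complex.ofRealCLM ∘ Θ)) :=
      HasCompactSupport.iteratedFDeriv (hc.comp_left rfl) i
    obtain ⟨C, hC⟩ := (hΘc.continuous_iteratedFDeriv (m := i)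
      (by exact_mod_cast le_top)).bounded_above_of_compact_support hci
    refine ⟨1 + C, fun ξ => ?_⟩
    have h2 : iteratedFDeriv ℝ i G ξ = iteratedFDeriv ℝ i (fun _ : Space d => (1 : ℂ)) ξ -
        iteratedFDeriv ℝ i (Complex.ofRealCLM ∘ Θ) ξ := by
      have := iteratedFDeriv_sub_apply (𝕜 := ℝ) (i := i) (x := ξ)
        (f := fun _ : Space d => (1 : ℂ)) (g := Complex.ofRealCLM ∘ Θ) contDiff_const.contDiffAt
        (hΘc.of_le (by exact_mod_cast le_top)).contDiffAt
      exact this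
    rw [h2]
    refine (norm_sub_le _ _).trans (add_le_add ?_ (hC ξ))
    cases i with
    | zero => simp
    | succ i => simp [iteratedFDeriv_const_of_ne (Nat.succ_ne_zero i)]
  choose B hB using hG1
  have hGN : ∀ (N : ℕ) i ξ, ‖iteratedFDeriv ℝ i (fun ξ => G ((2 : ℝ) ^ (-(N : ℤ)) • ξ)) ξ‖ ≤ B i := by
    intro N i ξ
    rw [hGd, norm_smul, norm_pow, Real.norm_of_nonneg (by positivity)]
    refine (mul_le_of_le_one_left (norm_nonneg _) (pow_le_one₀ (by positivity) ?_)).trans (hB i _)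
    exact zpow_le_one_of_nonpos₀ one_le_two (by simp)
  have hGz : ∀ (N : ℕ) i ξ, ‖ξ‖ < 2 ^ N * r →
      iteratedFDeriv ℝ i (fun ξ => G ((2 : ℝ) ^ (-(N : ℤ)) • ξ)) ξ = 0 := by
    intro N i ξ hξ
    have hlt : ‖(2 : ℝ) ^ (-(N : ℤ)) • ξ‖ < r := by
      rw [norm_smul, Real.norm_of_nonneg (by positivity), zpow_neg, zpow_natCast,
        inv_mul_lt_iff₀ (by positivity)]
      exact hξ
    have hev : G =ᶠ[nhds ((2 : ℝ) ^ (-(N : ℤ)) • ξ)] fun _ => 0 := by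
      filter_upwards [(isOpen_lt continuous_norm continuous_const).mem_nhds hlt] with η hη
      simp [G, h1 η hη.le]
    rw [hGd, (hev.iteratedFDeriv ℝ i).eq_of_nhds]
    simp
  set D : ℝ := ∑ i ∈ Finset.range (m + 1),
    (m.choose i : ℝ) * (B i * SchwartzMap.seminorm ℝ (k + 1) (m - i) ψ) with hD
  have hB0 : ∀ i, 0 ≤ B i := fun i => (norm_nonneg _).trans (hB i 0)
  have hD0 : 0 ≤ D := Finset.sum_nonneg fun i _ =>
    mul_nonneg (Nat.cast_nonneg _) (mul_nonneg (hB0 i) (apply_nonneg _ _))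
  have hlim : Filter.Tendsto (fun N : ℕ => D / (2 ^ N * r)) Filter.atTop (nhds 0) :=
    Filter.Tendsto.div_atTop tendsto_const_nhds
      ((tendsto_pow_atTop_atTop_of_one_lt one_lt_two).atTop_mul_const hr)
  filter_upwards [hlim.eventually (gt_mem_nhds hε)] with N hN
  refine lt_of_le_of_lt ?_ hN
  refine SchwartzMap.seminorm_le_bound ℝ k m _ (by positivity) fun ξ => ?_
  have hfun : ⇑(SchwartzMap.smulLeftCLM ℂ (fun ξ => (Θ ((2 : ℝ) ^ (-(N : ℤ)) • ξ) : ℂ)) ψ - ψ) =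
      -fun ξ => G ((2 : ℝ) ^ (-(N : ℤ)) • ξ) • ψ ξ := by
    ext ξ
    simp only [sub_apply, SchwartzMap.smulLeftCLM_apply_apply (htg N), G,
      Pi.neg_apply, smul_eq_mul]
    ring
  rw [hfun, iteratedFDeriv_neg_apply, norm_neg]
  have hle := norm_iteratedFDeriv_smul_le (𝕜 := ℝ) (N := (⊤ : ℕ∞))
    (hGs.comp (contDiff_const_smul ((2 : ℝ) ^ (-(N : ℤ))))) (ψ.smooth ⊤) ξ (n := m)
    (by exact_mod_cast le_top)
  refine (mul_le_mul_of_nonneg_left hle (by positivity)).trans ?_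
  rcases lt_or_ge ‖ξ‖ (2 ^ N * r) with hξ | hξ
  · have : ∀ i, iteratedFDeriv ℝ i (G ∘ fun ξ => (2 : ℝ) ^ (-(N : ℤ)) • ξ) ξ = 0 :=
      fun i => hGz N i ξ hξ
    simp only [this, norm_zero, mul_zero, zero_mul, Finset.sum_const_zero]
    positivity
  · rw [le_div_iff₀ (by positivity), hD, Finset.mul_sum, Finset.sum_mul]
    refine Finset.sum_le_sum fun i _ => ?_
    have e1 : ‖iteratedFDeriv ℝ i (G ∘ fun ξ => (2 : ℝ) ^ (-(N : ℤ)) • ξ) ξ‖ ≤ B i := hGN N i ξ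
    have e2 := SchwartzMap.le_seminorm ℝ (k + 1) (m - i) ψ ξ
    have e3 : ‖ξ‖ ^ k * ‖iteratedFDeriv ℝ (m - i) ψ ξ‖ * (2 ^ N * r) ≤
        SchwartzMap.seminorm ℝ (k + 1) (m - i) ψ := by
      refine le_trans ?_ e2
      rw [pow_succ, mul_right_comm]
      gcongr
    calc ‖ξ‖ ^ k * ((m.choose i : ℝ) *
          ‖iteratedFDeriv ℝ i (G ∘ fun ξ => (2 : ℝ) ^ (-(N : ℤ)) • ξ) ξ‖ *
            ‖iteratedFDeriv ℝ (m - i) ψ ξ‖) * (2 ^ N * r)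
        = (m.choose i : ℝ) * (‖iteratedFDeriv ℝ i (G ∘ fun ξ => (2 : ℝ) ^ (-(N : ℤ)) • ξ) ξ‖ *
            (‖ξ‖ ^ k * ‖iteratedFDeriv ℝ (m - i) ψ ξ‖ * (2 ^ N * r))) := by ring
      _ ≤ _ := by gcongr; exact hB0 i

/-! ### Fourier densities of functions with summable dyadic blocks -/

/-- The weight `2^{nd/2}` of Bernstein's inequality at frequency `2^n`. -/
def bernsteinWeight (d n : ℕ) : ℝ≥0∞ := ENNReal.ofReal ((2 : ℝ) ^ ((n : ℝ) * ((d : ℝ) / 2)))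

/-- The constant of Bernstein's inequality. -/
def bernsteinConst (d : ℕ) : ℝ≥0∞ := volume (Metric.ball (0 : Space d) 1) ^ (1 / 2 : ℝ)

lemma bernsteinWeight_ne_zero (d n : ℕ) : bernsteinWeight d n ≠ 0 := by
  simp only [bernsteinWeight, ne_eq, ENNReal.ofReal_eq_zero, not_le]
  positivity

lemma bernsteinConst_lt_top (d : ℕ) : bernsteinConst d < ∞ :=
  ENNReal.rpow_lt_top_of_nonneg (by norm_num) measure_ball_lt_top.ne

lemma volume_closedBall_rpow (n : ℕ) :
    volume (Metric.closedBall (0 : Space d) (2 ^ n)) ^ (1 / 2 : ℝ) =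
      bernsteinConst d * bernsteinWeight d n := by
  rw [Measure.addHaar_closedBall _ _ (by positivity), ENNReal.mul_rpow_of_nonneg _ _ (by norm_num),
    mul_comm, bernsteinConst, bernsteinWeight, ENNReal.ofReal_rpow_of_nonneg (by positivity)
    (by norm_num)]
  congr 2
  rw [finrank_euclideanSpace_fin, ← pow_mul, ← Real.rpow_natCast, ← Real.rpow_mul (by norm_num)]
  congr 1
  push_cast
  ring

/-- Bernstein's inequality on the Fourier side. -/
lemma LittlewoodPaley.eLpNorm_one_sym_mul_le (L : LittlewoodPaley d) (n : ℕ) {F : Space d → ℂ}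
    (hF : AEStronglyMeasurable F volume) :
    eLpNorm (fun ξ => (L.sym n ξ : ℂ) * F ξ) 1 volume ≤
      bernsteinConst d * bernsteinWeight d n *
        eLpNorm (fun ξ => (L.sym n ξ : ℂ) * F ξ) 2 volume := by
  have hs : support (fun ξ => (L.sym n ξ : ℂ) * F ξ) ⊆ Metric.closedBall 0 (2 ^ n) := by
    intro ξ hξ
    have : L.sym n ξ ≠ 0 := by
      intro h0
      simp [h0] at hξ
    simpa using L.norm_le_of_sym_ne_zero this
  have hm : AEStronglyMeasurable (fun ξ => (L.sym n ξ : ℂ) * F ξ) volume :=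
    (Complex.continuous_ofReal.comp (L.continuous_sym n)).aestronglyMeasurable.mul hF
  rw [← eLpNorm_restrict_eq_of_support_subset (p := 1) hs,
    ← eLpNorm_restrict_eq_of_support_subset (p := 2) hs]
  have h := eLpNorm_le_eLpNorm_mul_rpow_measure_univ (p := 1) (q := 2) one_le_two
    (hm.restrict (s := Metric.closedBall 0 (2 ^ n)))
  have h2 : 1 / (1 : ℝ≥0∞).toReal - 1 / (2 : ℝ≥0∞).toReal = (1 / 2 : ℝ) := by norm_num
  rwa [h2, Measure.restrict_apply_univ, volume_closedBall_rpow, mul_comm] at h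

lemma LittlewoodPaley.enorm_eq_tsum_sym (L : LittlewoodPaley d) (F : Space d → ℂ) (ξ : Space d) :
    ‖F ξ‖ₑ = ∑' n, ‖(L.sym n ξ : ℂ) * F ξ‖ₑ := by
  have h : ∀ n, ‖(L.sym n ξ : ℂ)‖ₑ = ENNReal.ofReal (L.sym n ξ) := fun n => by
    rw [← ofReal_norm, Complex.norm_real, Real.norm_of_nonneg (L.sym_nonneg n ξ)]
  simp_rw [enorm_mul, h]
  rw [ENNReal.tsum_mul_right, ← ENNReal.ofReal_tsum_of_nonneg (fun n => L.sym_nonneg n ξ)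
    (L.hasSum_sym ξ).summable, (L.hasSum_sym ξ).tsum_eq]
  simp

lemma LittlewoodPaley.lintegral_enorm_le (L : LittlewoodPaley d) {F : Space d → ℂ}
    (hF : AEStronglyMeasurable F volume) :
    ∫⁻ ξ, ‖F ξ‖ₑ ≤ bernsteinConst d * ∑' n : ℕ, bernsteinWeight d n *
      eLpNorm (fun ξ => (L.sym n ξ : ℂ) * F ξ) 2 volume := by
  calc ∫⁻ ξ, ‖F ξ‖ₑ = ∫⁻ ξ, ∑' n, ‖(L.sym n ξ : ℂ) * F ξ‖ₑ := by
        simp_rw [← L.enorm_eq_tsum_sym F]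
    _ = ∑' n, ∫⁻ ξ, ‖(L.sym n ξ : ℂ) * F ξ‖ₑ := by
      refine lintegral_tsum fun n => ?_
      exact ((Complex.continuous_ofReal.comp
        (L.continuous_sym n)).aestronglyMeasurable.mul hF).enorm
    _ ≤ _ := by
      rw [← ENNReal.tsum_mul_left]
      refine ENNReal.tsum_le_tsum fun n => ?_
      rw [← eLpNorm_one_eq_lintegral_enorm, ← mul_assoc]
      exact L.eLpNorm_one_sym_mul_le n hF

lemma isRegular_Lp (w : Lp ℂ 2 (volume : Measure (Space d))) :
    IsRegular (w : 𝓢'(Space d, ℂ)) w := by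
  refine ⟨Lp.aestronglyMeasurable w, fun ψ => ⟨?_, by simp⟩⟩
  exact (ψ.memLp 2).integrable_mul (Lp.memLp w)

lemma IsRegular.smulLeftCLM {u : 𝓢'(Space d, ℂ)} {h : Space d → ℂ} (hu : IsRegular u h)
    {g : Space d → ℂ} (hg : g.HasTemperateGrowth) :
    IsRegular (TemperedDistribution.smulLeftCLM ℂ g u) (fun x => g x * h x) := by
  have he : ∀ ψ : 𝓢(Space d, ℂ), (fun x => ψ x • (g x * h x)) =
      fun x => SchwartzMap.smulLeftCLM ℂ g ψ x • h x := by
    intro ψ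
    ext x
    rw [SchwartzMap.smulLeftCLM_apply_apply hg]
    simp only [smul_eq_mul]; ring
  refine ⟨hg.1.continuous.aestronglyMeasurable.mul hu.1, fun ψ => ?_⟩
  rw [he, TemperedDistribution.smulLeftCLM_apply_apply]
  exact hu.2 _

lemma continuous_neg_inner :
    Continuous fun p : Space d × Space d => (-innerₗ (Space d)) p.1 p.2 := by
  have : Continuous fun p : Space d × Space d => -(inner ℝ p.1 p.2 : ℝ) := by fun_prop
  simpa using this

lemma integral_fourierInv_smul {F G : Space d → ℂ} (hF : Integrable F) (hG : Integrable G) :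
    ∫ x, 𝓕⁻ F x • G x = ∫ ξ, F ξ • 𝓕⁻ G ξ := by
  have h := VectorFourier.integral_fourierIntegral_smul_eq_flip (μ := volume) (ν := volume)
    (L := -innerₗ (Space d)) Real.continuous_fourierChar
    continuous_neg_inner hF hG
  have hflip : (-innerₗ (Space d)).flip = -innerₗ (Space d) := by
    ext x y; simp [real_inner_comm]
  rw [hflip] at h
  exact h

lemma continuous_fourierInv {F : Space d → ℂ} (hF : Integrable F) : Continuous (𝓕⁻ F) :=
  VectorFourier.fourierIntegral_continuous Real.continuous_fourierChar
    continuous_neg_inner hF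

lemma norm_fourierInv_le (F : Space d → ℂ) (x : Space d) : ‖𝓕⁻ F x‖ ≤ ∫ ξ, ‖F ξ‖ :=
  VectorFourier.norm_fourierIntegral_le_integral_norm _ _ _ _ _

lemma isRegular_of_bounded {h : Space d → ℂ} (hm : AEStronglyMeasurable h volume) {K : ℝ}
    (hK : ∀ᵐ x, ‖h x‖ ≤ K) : ∃ u : 𝓢'(Space d, ℂ), IsRegular u h := by
  have hp : MemLp h ∞ volume := memLp_top_of_bound hm K hK
  refine ⟨(hp.toLp h : Lp ℂ ∞ (volume : Measure (Space d))), hm, fun ψ => ⟨?_, ?_⟩⟩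
  · exact ψ.integrable.mul_bdd hm hK
  · rw [Lp.toTemperedDistribution_apply]
    refine integral_congr_ae ?_
    filter_upwards [hp.coeFn_toLp] with x hx
    rw [hx]

/-- A function whose dyadic blocks are summable with Bernstein's weights is the inverse Fourier
transform of an integrable function. The density `F` is assembled from the Fourier transforms
`F_n ∈ L²` of the blocks: since `σ_j F_k = σ_k F_j`, it satisfies `σ_j F = F_j`. -/
theorem LittlewoodPaley.exists_fourierDensity (L : LittlewoodPaley d) {h : Space d → ℂ}
    (hsum : ∑' n : ℕ, bernsteinWeight d n * L.blockNorm ((n : ℤ) - 1) h < ∞) :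
    ∃ F : Space d → ℂ, Integrable F ∧ h =ᵐ[volume] 𝓕⁻ F ∧
      ∀ n : ℕ, eLpNorm (fun ξ => (L.sym n ξ : ℂ) * F ξ) 2 volume =
        L.blockNorm ((n : ℤ) - 1) h := by
  have hfin : ∀ n : ℕ, L.blockNorm ((n : ℤ) - 1) h < ∞ := by
    intro n
    refine lt_top_iff_ne_top.2 fun hn => ?_
    have := (ENNReal.le_tsum n).trans_lt hsum
    rw [hn, ENNReal.mul_top (bernsteinWeight_ne_zero d n)] at this
    exact lt_irrefl _ this
  obtain ⟨u, hu⟩ := exists_isRegular_of_blockNorm_lt_top (hfin 0)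
  -- the Fourier transforms of the blocks
  have hF : ∀ n : ℕ, ∃ w : Lp ℂ 2 (volume : Measure (Space d)),
      (w : 𝓢'(Space d, ℂ)) = TemperedDistribution.smulLeftCLM ℂ (fun ξ => (L.sym n ξ : ℂ)) (𝓕 u) ∧
        ‖w‖ₑ = L.blockNorm ((n : ℤ) - 1) h := by
    intro n
    have hn := hfin n
    rw [hu.blockNorm_eq] at hn
    obtain ⟨w, hw, hwn⟩ := exists_eq_of_l2Norm_lt_top hn
    refine ⟨𝓕 w, ?_, ?_⟩
    · rw [← Lp.fourier_toTemperedDistribution_eq, hw]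
      change 𝓕 (𝓕⁻ (TemperedDistribution.smulLeftCLM ℂ (fun ξ => (L.sym n ξ : ℂ)) (𝓕 u))) = _
      rw [fourier_fourierInv_eq]
    · rw [← ofReal_norm, Lp.norm_fourier_eq, ofReal_norm, hwn, hu.blockNorm_eq]
  choose W hW hWn using hF
  have hcomm : ∀ᵐ ξ, ∀ j k : ℕ, (L.sym j ξ : ℂ) * W k ξ = (L.sym k ξ : ℂ) * W j ξ := by
    rw [ae_all_iff]; intro j
    rw [ae_all_iff]; intro k
    have h1 := (isRegular_Lp (W k)).smulLeftCLM (L.hasTemperateGrowth_sym j)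
    have h2 := (isRegular_Lp (W j)).smulLeftCLM (L.hasTemperateGrowth_sym k)
    rw [hW, TemperedDistribution.smulLeftCLM_smulLeftCLM_apply (L.hasTemperateGrowth_sym k)
      (L.hasTemperateGrowth_sym j)] at h1
    rw [hW, TemperedDistribution.smulLeftCLM_smulLeftCLM_apply (L.hasTemperateGrowth_sym j)
      (L.hasTemperateGrowth_sym k), mul_comm] at h2
    exact h1.ae_eq h2
  let F : Space d → ℂ := fun ξ => ∑' k, W k ξ
  have hsymC : ∀ ξ, HasSum (fun n => (L.sym n ξ : ℂ)) 1 := fun ξ => by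
    simpa using (L.hasSum_sym ξ).mapL Complex.ofRealCLM
  have hFW : ∀ᵐ ξ, ∀ j : ℕ, (L.sym j ξ : ℂ) * F ξ = W j ξ := by
    filter_upwards [hcomm] with ξ hξ j
    rw [← tsum_mul_left]
    simp_rw [hξ j]
    rw [tsum_mul_right, (hsymC ξ).tsum_eq, one_mul]
  have hFm : AEStronglyMeasurable F volume := by
    refine aestronglyMeasurable_of_tendsto_ae (u := Filter.atTop)
      (f := fun N ξ => ∑ k ∈ Finset.range N, W k ξ) ?_ ?_
    · intro N
      exact Finset.aestronglyMeasurable_fun_sum _ fun k _ => Lp.aestronglyMeasurable (W k)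
    · filter_upwards [hFW] with ξ hξ
      have := (hsymC ξ).mul_right (F ξ)
      simp only [hξ, one_mul] at this
      exact this.tendsto_sum_nat
  have hFn : ∀ n : ℕ, eLpNorm (fun ξ => (L.sym n ξ : ℂ) * F ξ) 2 volume =
      L.blockNorm ((n : ℤ) - 1) h := by
    intro n
    rw [← hWn n, Lp.enorm_def]
    refine eLpNorm_congr_ae ?_
    filter_upwards [hFW] with ξ hξ using hξ n
  have hFi : Integrable F := by
    refine ⟨hFm, ?_⟩
    refine (L.lintegral_enorm_le hFm).trans_lt ?_
    simp_rw [hFn]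
    exact ENNReal.mul_lt_top (bernsteinConst_lt_top d) hsum
  refine ⟨F, hFi, ?_, hFn⟩
  -- the tempered distribution `𝓕 u` is the function `F`
  have hkey : ∀ θ : 𝓢(Space d, ℂ), (𝓕 u) θ = ∫ ξ, θ ξ • F ξ := by
    intro θ
    have hcut := tendsto_cutoff_smul (L.contDiff_sym 0) (L.hasCompactSupport_sym 0)
      (r := 1 / 10) (by norm_num) (fun ξ hξ => L.sym_zero_eq_one hξ) θ
    have h1 := ((𝓕 u).continuous.tendsto θ).comp hcut
    refine tendsto_nhds_unique h1 ?_
    have h2 : ∀ N : ℕ, (𝓕 u) (SchwartzMap.smulLeftCLM ℂ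
        (fun ξ => (L.sym 0 ((2 : ℝ) ^ (-(N : ℤ)) • ξ) : ℂ)) θ) =
        ∫ ξ, (L.sym 0 ((2 : ℝ) ^ (-(N : ℤ)) • ξ) : ℂ) * (θ ξ • F ξ) := by
      intro N
      have h3 : (fun ξ => (L.sym 0 ((2 : ℝ) ^ (-(N : ℤ)) • ξ) : ℂ)) =
          fun ξ => ∑ n ∈ Finset.range (N + 1), (L.sym n ξ : ℂ) := by
        ext ξ
        rw [← L.sum_sym N ξ]
        push_cast
        rfl
      have h4 : ∀ n : ℕ, (𝓕 u) (SchwartzMap.smulLeftCLM ℂ (fun ξ => (L.sym n ξ : ℂ)) θ) =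
          ∫ ξ, θ ξ • W n ξ := by
        intro n
        rw [← TemperedDistribution.smulLeftCLM_apply_apply, ← hW n]
        simp
      rw [h3, SchwartzMap.smulLeftCLM_sum fun n _ => L.hasTemperateGrowth_sym n]
      simp only [sum_apply, map_sum, h4]
      rw [← integral_finsetSum _ fun n _ => ((isRegular_Lp (W n)).2 θ).1]
      refine integral_congr_ae ?_
      filter_upwards [hFW] with ξ hξ
      have h5 := congrFun h3 ξ
      rw [h5, Finset.sum_mul]
      refine Finset.sum_congr rfl fun n _ => ?_
      rw [← hξ n]
      simp only [smul_eq_mul]; ring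
    have h6 : Integrable (fun ξ => θ ξ • F ξ) := by
      have hb := θ.toBoundedContinuousFunction.norm_coe_le_norm
      exact hFi.bdd_mul θ.continuous.aestronglyMeasurable (Filter.Eventually.of_forall hb)
    refine Filter.Tendsto.congr (fun N => (h2 N).symm) ?_
    refine tendsto_integral_of_dominated_convergence (fun ξ => ‖θ ξ • F ξ‖) ?_ h6.norm ?_ ?_
    · intro N
      refine AEStronglyMeasurable.mul ?_ h6.1
      exact (Complex.continuous_ofReal.comp ((L.continuous_sym 0).comp
        (continuous_const_smul _))).aestronglyMeasurable
    · intro N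
      refine Filter.Eventually.of_forall fun ξ => ?_
      rw [norm_mul, Complex.norm_real, Real.norm_of_nonneg (L.sym_nonneg 0 _)]
      exact mul_le_of_le_one_left (norm_nonneg _) (L.sym_le_one 0 _)
    · refine Filter.Eventually.of_forall fun ξ => ?_
      have h7 : Filter.Tendsto (fun N : ℕ => (L.sym 0 ((2 : ℝ) ^ (-(N : ℤ)) • ξ) : ℂ))
          Filter.atTop (nhds 1) := by
        have := (hsymC ξ).tendsto_sum_nat.comp (Filter.tendsto_add_atTop_nat 1)
        refine this.congr fun N => ?_
        rw [← L.sum_sym N ξ]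
        simp
      simpa using h7.mul_const (θ ξ • F ξ)
  refine hu.ae_eq ⟨(continuous_fourierInv hFi).aestronglyMeasurable, fun ψ => ⟨?_, ?_⟩⟩
  · exact ψ.integrable.mul_bdd (continuous_fourierInv hFi).aestronglyMeasurable
      (Filter.Eventually.of_forall (norm_fourierInv_le F))
  · have h1 : u ψ = (𝓕 u) (𝓕⁻ ψ) := by simp
    rw [h1, hkey]
    have h2 := integral_fourierInv_smul ψ.integrable hFi
    rw [← h2, ← SchwartzMap.fourierInv_coe]

/-! ### Dyadic blocks of a product -/

/-- The Fourier transform turns the product of two functions with densities `F₁`, `F₂` into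
the convolution of the densities, here tested against a Schwartz function. -/
lemma integral_mul_fourier {F₁ F₂ : Space d → ℂ} (h₁ : Integrable F₁) (h₂ : Integrable F₂)
    (τ : 𝓢(Space d, ℂ)) :
    ∫ x, (𝓕⁻ F₁ x * 𝓕⁻ F₂ x) * (𝓕 τ) x = ∫ ξ, F₁ ξ * ∫ η, F₂ η * τ (ξ + η) := by
  have hi : Integrable (fun x => 𝓕⁻ F₂ x * (𝓕 τ) x) :=
    (𝓕 τ).integrable.bdd_mul (continuous_fourierInv h₂).aestronglyMeasurable
      (Filter.Eventually.of_forall (norm_fourierInv_le F₂))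
  have h := integral_fourierInv_smul h₁ hi
  simp only [smul_eq_mul] at h
  simp_rw [mul_assoc]
  rw [h]
  congr 1 with ξ
  congr 1
  -- modulation by the character of frequency `ξ` translates the transform
  have hmod : Integrable (fun x => (Real.fourierChar (inner ℝ x ξ) : ℂ) * (𝓕 τ) x) := by
    refine (𝓕 τ).integrable.bdd_mul (c := 1) ?_
      (Filter.Eventually.of_forall fun x => (Circle.norm_coe _).le)
    exact (continuous_subtype_val.comp
      (Real.continuous_fourierChar.comp (by fun_prop))).aestronglyMeasurable
  have h3 := integral_fourierInv_smul h₂ hmod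
  rw [Real.fourierInv_eq]
  have h4 : ∀ η, 𝓕⁻ (fun x => (Real.fourierChar (inner ℝ x ξ) : ℂ) * (𝓕 τ) x) η = τ (ξ + η) := by
    intro η
    have h5 : τ (ξ + η) = 𝓕⁻ ((𝓕 τ : 𝓢(Space d, ℂ)) : Space d → ℂ) (ξ + η) := by
      rw [← SchwartzMap.fourierInv_coe, fourierInv_fourier_eq]
    rw [h5, Real.fourierInv_eq, Real.fourierInv_eq]
    congr 1 with x
    simp only [Circle.smul_def, smul_eq_mul, inner_add_right, AddChar.map_add_eq_mul,
      Circle.coe_mul]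
    ring
  simp only [smul_eq_mul, h4] at h3
  rw [← h3]
  congr 1 with x
  simp only [Circle.smul_def, smul_eq_mul]
  ring

/-- Young's inequality `L¹ * L² * L² → L¹` for a trilinear form. -/
lemma lintegral_lintegral_mul_add_le {A B T : Space d → ℝ≥0∞}
    (hA : AEMeasurable A) (hB : AEMeasurable B) (hT : Measurable T) :
    ∫⁻ ξ, A ξ * ∫⁻ η, B η * T (ξ + η) ≤
      (∫⁻ ξ, A ξ) * ((∫⁻ η, B η ^ (2 : ℝ)) ^ (1 / 2 : ℝ) * (∫⁻ η, T η ^ (2 : ℝ)) ^ (1 / 2 : ℝ)) := by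
  have h : ∀ ξ, ∫⁻ η, B η * T (ξ + η) ≤
      (∫⁻ η, B η ^ (2 : ℝ)) ^ (1 / 2 : ℝ) * (∫⁻ η, T η ^ (2 : ℝ)) ^ (1 / 2 : ℝ) := by
    intro ξ
    have h1 := ENNReal.lintegral_mul_le_Lp_mul_Lq volume Real.HolderConjugate.two_two hB
      (hT.comp (measurable_const_add ξ)).aemeasurable
    have h2 : ∫⁻ η, (T ∘ (fun η => ξ + η)) η ^ (2 : ℝ) = ∫⁻ η, T η ^ (2 : ℝ) :=
      lintegral_add_left_eq_self (fun η => T η ^ (2 : ℝ)) ξ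
    rw [h2] at h1
    exact h1
  rw [← lintegral_mul_const'' _ hA]
  exact lintegral_mono fun ξ => by gcongr; exact h ξ

lemma lintegral_lintegral_mul_add_swap {A B T : Space d → ℝ≥0∞} (hA : AEMeasurable A)
    (hB : AEMeasurable B) (hT : Measurable T) :
    ∫⁻ ξ, A ξ * ∫⁻ η, B η * T (ξ + η) = ∫⁻ η, B η * ∫⁻ ξ, A ξ * T (η + ξ) := by
  have hTm : ∀ ξ, AEMeasurable (fun η => T (ξ + η)) := fun ξ =>
    (hT.comp (measurable_const_add ξ)).aemeasurable
  calc ∫⁻ ξ, A ξ * ∫⁻ η, B η * T (ξ + η) = ∫⁻ ξ, ∫⁻ η, A ξ * (B η * T (ξ + η)) := by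
        congr 1 with ξ
        exact (lintegral_const_mul'' _ (hB.mul (hTm ξ))).symm
    _ = ∫⁻ η, ∫⁻ ξ, A ξ * (B η * T (ξ + η)) := by
        refine lintegral_lintegral_swap ?_
        exact hA.comp_fst.mul (hB.comp_snd.mul (hT.comp measurable_add).aemeasurable)
    _ = _ := by
        congr 1 with η
        refine Eq.trans ?_ (lintegral_const_mul'' _ (hA.mul (hTm η)))
        congr 1 with ξ
        rw [add_comm η ξ]
        ring

/-- The bound for the `j`-th dyadic block of a product in terms of the norms `a`, `b` of the blocks
of its factors: the lower of the two frequencies costs Bernstein's weight, and the frequency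
of the product exceeds the higher one by two octaves at most. -/
def productBound (d j : ℕ) (a b : ℕ → ℝ≥0∞) : ℝ≥0∞ :=
  bernsteinConst d * ∑' p, ∑' q,
    if j ≤ max p q + 2 then bernsteinWeight d (min p q) * (a p * b q) else 0

lemma LittlewoodPaley.enorm_integral_mul_block_le (L : LittlewoodPaley d) (j : ℕ)
    {F₁ F₂ : Space d → ℂ} (h₁ : Integrable F₁) (h₂ : Integrable F₂) (θ : 𝓢(Space d, ℂ)) :
    ‖∫ x, (𝓕⁻ F₁ x * 𝓕⁻ F₂ x) *
        (𝓕 (SchwartzMap.smulLeftCLM ℂ (fun ξ => (L.sym j ξ : ℂ)) θ)) x‖ₑ ≤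
      productBound d j (fun p => eLpNorm (fun ξ => (L.sym p ξ : ℂ) * F₁ ξ) 2 volume)
        (fun q => eLpNorm (fun ξ => (L.sym q ξ : ℂ) * F₂ ξ) 2 volume) * ‖θ.toLp 2‖ₑ := by
  set A : ℕ → Space d → ℝ≥0∞ := fun p ξ => ‖(L.sym p ξ : ℂ) * F₁ ξ‖ₑ with hAdef
  set B : ℕ → Space d → ℝ≥0∞ := fun q ξ => ‖(L.sym q ξ : ℂ) * F₂ ξ‖ₑ with hBdef
  set T : Space d → ℝ≥0∞ := fun ξ => ‖(L.sym j ξ : ℂ) * θ ξ‖ₑ with hTdef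
  have hsymc : ∀ n, Continuous fun ξ => (L.sym n ξ : ℂ) := fun n =>
    Complex.continuous_ofReal.comp (L.continuous_sym n)
  have hAm : ∀ p, AEMeasurable (A p) := fun p =>
    ((hsymc p).aestronglyMeasurable.mul h₁.1).enorm
  have hBm : ∀ q, AEMeasurable (B q) := fun q =>
    ((hsymc q).aestronglyMeasurable.mul h₂.1).enorm
  have hTm : Measurable T := ((hsymc j).mul θ.continuous).enorm.measurable
  have hTm' : ∀ ξ, AEMeasurable (fun η => T (ξ + η)) := fun ξ =>
    (hTm.comp (measurable_const_add ξ)).aemeasurable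
  have h2norm : ∀ G : Space d → ℂ,
      (∫⁻ ξ, ‖G ξ‖ₑ ^ (2 : ℝ)) ^ (1 / 2 : ℝ) = eLpNorm G 2 volume := by
    intro G
    rw [eLpNorm_eq_lintegral_rpow_enorm_toReal (by norm_num) (by norm_num)]
    norm_num
  have hT2 : (∫⁻ ξ, T ξ ^ (2 : ℝ)) ^ (1 / 2 : ℝ) ≤ ‖θ.toLp 2‖ₑ := by
    rw [hTdef, h2norm, Lp.enorm_def, eLpNorm_congr_ae (θ.coeFn_toLp 2 volume)]
    refine eLpNorm_mono fun ξ => ?_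
    rw [norm_mul, Complex.norm_real, Real.norm_of_nonneg (L.sym_nonneg j ξ)]
    exact mul_le_of_le_one_left (norm_nonneg _) (L.sym_le_one j ξ)
  have hsplit : ‖∫ x, (𝓕⁻ F₁ x * 𝓕⁻ F₂ x) *
      (𝓕 (SchwartzMap.smulLeftCLM ℂ (fun ξ => (L.sym j ξ : ℂ)) θ)) x‖ₑ ≤
        ∑' p, ∑' q, ∫⁻ ξ, A p ξ * ∫⁻ η, B q η * T (ξ + η) := by
    rw [integral_mul_fourier h₁ h₂]
    calc _ ≤ ∫⁻ ξ, ‖F₁ ξ‖ₑ * ∫⁻ η, ‖F₂ η‖ₑ * T (ξ + η) := by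
          refine (enorm_integral_le_lintegral_enorm _).trans (lintegral_mono fun ξ => ?_)
          rw [enorm_mul]
          gcongr
          refine (enorm_integral_le_lintegral_enorm _).trans (lintegral_mono fun η => ?_)
          rw [enorm_mul, SchwartzMap.smulLeftCLM_apply_apply (L.hasTemperateGrowth_sym j)]
          rfl
      _ = ∫⁻ ξ, ∑' p, ∑' q, A p ξ * ∫⁻ η, B q η * T (ξ + η) := by
          congr 1 with ξ
          rw [L.enorm_eq_tsum_sym F₁ ξ, ← ENNReal.tsum_mul_right]
          congr 1 with p
          rw [ENNReal.tsum_mul_left]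
          congr 1
          refine Eq.trans ?_ (lintegral_tsum fun q => (hBm q).mul (hTm' ξ))
          congr 1 with η
          rw [L.enorm_eq_tsum_sym F₂ η, ← ENNReal.tsum_mul_right]
      _ = _ := by
          have hm : ∀ p q, AEMeasurable fun ξ => A p ξ * ∫⁻ η, B q η * T (ξ + η) := by
            intro p q
            have h3 : AEMeasurable (fun z : Space d × Space d => B q z.2 * T (z.1 + z.2))
                (volume.prod volume) :=
              (hBm q).comp_snd.mul (hTm.comp measurable_add).aemeasurable
            exact (hAm p).mul h3.lintegral_prod_right'
          rw [lintegral_tsum fun p => AEMeasurable.tsum fun q => hm p q]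
          congr 1 with p
          rw [lintegral_tsum fun q => hm p q]
  refine hsplit.trans ?_
  rw [productBound, mul_assoc, ← ENNReal.tsum_mul_right, ← ENNReal.tsum_mul_left]
  refine ENNReal.tsum_le_tsum fun p => ?_
  rw [← ENNReal.tsum_mul_right, ← ENNReal.tsum_mul_left]
  refine ENNReal.tsum_le_tsum fun q => ?_
  split_ifs with hj
  · rcases le_total q p with hqp | hpq
    · -- the factor of lower frequency is measured in `L¹`
      rw [min_eq_right hqp, lintegral_lintegral_mul_add_swap (hAm p) (hBm q) hTm]
      refine (lintegral_lintegral_mul_add_le (hBm q) (hAm p) hTm).trans ?_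
      have h1 := L.eLpNorm_one_sym_mul_le q h₂.1
      rw [eLpNorm_one_eq_lintegral_enorm] at h1
      calc _ ≤ (bernsteinConst d * bernsteinWeight d q *
            eLpNorm (fun ξ => (L.sym q ξ : ℂ) * F₂ ξ) 2 volume) *
            (eLpNorm (fun ξ => (L.sym p ξ : ℂ) * F₁ ξ) 2 volume * ‖θ.toLp 2‖ₑ) := by
            rw [hAdef, h2norm]
            gcongr
        _ = _ := by ring
    · rw [min_eq_left hpq]
      refine (lintegral_lintegral_mul_add_le (hAm p) (hBm q) hTm).trans ?_
      have h1 := L.eLpNorm_one_sym_mul_le p h₁.1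
      rw [eLpNorm_one_eq_lintegral_enorm] at h1
      calc _ ≤ (bernsteinConst d * bernsteinWeight d p *
            eLpNorm (fun ξ => (L.sym p ξ : ℂ) * F₁ ξ) 2 volume) *
            (eLpNorm (fun ξ => (L.sym q ξ : ℂ) * F₂ ξ) 2 volume * ‖θ.toLp 2‖ₑ) := by
            rw [hBdef, h2norm]
            gcongr
        _ = _ := by ring
  · have hz : ∀ ξ η, A p ξ * (B q η * T (ξ + η)) = 0 := by
      intro ξ η
      by_contra hne
      simp only [hAdef, hBdef, hTdef, mul_eq_zero, enorm_eq_zero, Complex.ofReal_eq_zero,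
        not_or] at hne
      exact hj (L.le_max_add_two hne.2.2.1 hne.1.1 hne.2.1.1)
    have hz' : ∀ ξ, A p ξ * ∫⁻ η, B q η * T (ξ + η) = 0 := by
      intro ξ
      have := lintegral_const_mul'' (A p ξ) ((hBm q).mul (hTm' ξ))
      simp only [Pi.mul_apply, hz, lintegral_zero] at this
      exact this.symm
    simp [hz']

/-! ### Summation over the dyadic scales -/

lemma ofReal_two_rpow_mul_dyadicSum (s : ℝ) (a : ℤ → ℝ≥0∞) :
    ENNReal.ofReal ((2 : ℝ) ^ s) * dyadicSum s a =
      ∑' n : ℕ, ENNReal.ofReal ((2 : ℝ) ^ s) ^ n * a ((n : ℤ) - 1) := by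
  have h2 : (0 : ℝ) < 2 := two_pos
  rw [tsum_eq_zero_add' ENNReal.summable, dyadicSum, mul_add, ← mul_assoc,
    ← ENNReal.ofReal_mul (by positivity), ← Real.rpow_add h2, ← ENNReal.tsum_mul_left]
  congr 1
  · simp
  · congr 1 with n
    rw [← mul_assoc, ← ENNReal.ofReal_mul (by positivity), ← Real.rpow_add h2,
      ← ENNReal.ofReal_pow (by positivity), ← Real.rpow_natCast, ← Real.rpow_mul h2.le]
    congr 3
    · push_cast; ring
    · push_cast; ring

lemma bernsteinWeight_le_pow {s : ℝ} (hs : (d : ℝ) / 2 ≤ s) (n : ℕ) :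
    bernsteinWeight d n ≤ ENNReal.ofReal ((2 : ℝ) ^ s) ^ n := by
  rw [bernsteinWeight, ← ENNReal.ofReal_pow (by positivity), ← Real.rpow_natCast,
    ← Real.rpow_mul two_pos.le]
  refine ENNReal.ofReal_le_ofReal (Real.rpow_le_rpow_of_exponent_le one_le_two ?_)
  rw [mul_comm s]
  gcongr

lemma tsum_bernsteinWeight_le {s : ℝ} (hs : (d : ℝ) / 2 ≤ s) (a : ℤ → ℝ≥0∞) :
    ∑' n : ℕ, bernsteinWeight d n * a ((n : ℤ) - 1) ≤
      ENNReal.ofReal ((2 : ℝ) ^ s) * dyadicSum s a := by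
  rw [ofReal_two_rpow_mul_dyadicSum]
  exact ENNReal.tsum_le_tsum fun n => by gcongr; exact bernsteinWeight_le_pow hs n

/-- Summing the geometric weights over the scales `j ≤ m + 2` only costs a constant. -/
lemma exists_tsum_ite_pow_le {r : ℝ} (hr : 1 < r) : ∃ C : ℝ≥0∞, C < ∞ ∧ ∀ m : ℕ,
    ∑' j : ℕ, (if j ≤ m + 2 then ENNReal.ofReal r ^ j else 0) ≤ C * ENNReal.ofReal r ^ m := by
  refine ⟨ENNReal.ofReal (r ^ 3 / (r - 1)), ENNReal.ofReal_lt_top, fun m => ?_⟩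
  have h0 : 0 < r := by linarith
  have h1 : 0 < r - 1 := by linarith
  have h2 : ∑' j : ℕ, (if j ≤ m + 2 then ENNReal.ofReal r ^ j else 0) =
      ∑ j ∈ Finset.range (m + 3), ENNReal.ofReal r ^ j := by
    rw [tsum_eq_sum (s := Finset.range (m + 3))]
    · refine Finset.sum_congr rfl fun j hj => ?_
      rw [Finset.mem_range] at hj
      rw [if_pos (by omega)]
    · intro j hj
      rw [Finset.mem_range] at hj
      rw [if_neg (by omega)]
  rw [h2, ← ENNReal.ofReal_pow h0.le, ← ENNReal.ofReal_mul (by positivity)]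
  simp_rw [← ENNReal.ofReal_pow h0.le]
  rw [← ENNReal.ofReal_sum_of_nonneg fun j _ => by positivity]
  refine ENNReal.ofReal_le_ofReal ?_
  rw [geom_sum_eq hr.ne', div_mul_eq_mul_div, div_le_div_iff_of_pos_right h1, pow_add]
  linarith [mul_comm (r ^ m) (r ^ 3)]

/-- The algebra property of the Besov norms: the bounds for the blocks of a product are summable
with the weights `2^{js}`, `s ≥ d/2`, `s > 0`. -/
lemma exists_dyadicSum_le {s : ℝ} (hs : (d : ℝ) / 2 ≤ s) (hs0 : 0 < s) :
    ∃ C : ℝ≥0∞, C < ∞ ∧ ∀ (a b c : ℤ → ℝ≥0∞) (D : ℝ≥0∞),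
      (∀ n : ℕ, c ((n : ℤ) - 1) ≤ D * productBound d n (fun p => a ((p : ℤ) - 1))
        (fun q => b ((q : ℤ) - 1))) →
      dyadicSum s c ≤ C * D * dyadicSum s a * dyadicSum s b := by
  set R : ℝ≥0∞ := ENNReal.ofReal ((2 : ℝ) ^ s) with hR
  obtain ⟨C₀, hC₀, hC⟩ := exists_tsum_ite_pow_le (Real.one_lt_rpow one_lt_two hs0)
  rw [← hR] at hC
  refine ⟨bernsteinConst d * C₀ * R, ENNReal.mul_lt_top (ENNReal.mul_lt_top
    (bernsteinConst_lt_top d) hC₀) ENNReal.ofReal_lt_top, fun a b c D h => ?_⟩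
  have hR0 : R ≠ 0 := by
    rw [hR, ne_eq, ENNReal.ofReal_eq_zero, not_le]; positivity
  have hRt : R ≠ ∞ := ENNReal.ofReal_ne_top
  rw [← ENNReal.mul_le_mul_iff_right hR0 hRt]
  have e1 := ofReal_two_rpow_mul_dyadicSum s a
  have e2 := ofReal_two_rpow_mul_dyadicSum s b
  rw [← hR] at e1 e2
  rw [hR, ofReal_two_rpow_mul_dyadicSum, ← hR]
  calc ∑' n : ℕ, R ^ n * c ((n : ℤ) - 1)
      ≤ ∑' n : ℕ, D * bernsteinConst d * ∑' p : ℕ, ∑' q : ℕ,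
          (if n ≤ max p q + 2 then R ^ n else 0) *
            (bernsteinWeight d (min p q) * (a ((p : ℤ) - 1) * b ((q : ℤ) - 1))) := by
        refine ENNReal.tsum_le_tsum fun n => ?_
        refine (mul_le_mul_right (h n) _).trans (le_of_eq ?_)
        have hcomm : ∀ X, R ^ n * (D * (bernsteinConst d * X)) =
            D * bernsteinConst d * (R ^ n * X) := fun X => by ring
        rw [productBound, hcomm, ← ENNReal.tsum_mul_left]
        congr 1
        congr 1 with p
        rw [← ENNReal.tsum_mul_left]
        congr 1 with q
        split_ifs <;> simp
    _ = D * bernsteinConst d * ∑' p : ℕ, ∑' q : ℕ,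
          (∑' n : ℕ, if n ≤ max p q + 2 then R ^ n else 0) *
            (bernsteinWeight d (min p q) * (a ((p : ℤ) - 1) * b ((q : ℤ) - 1))) := by
        rw [ENNReal.tsum_mul_left, ENNReal.tsum_comm]
        congr 1
        congr 1 with p
        rw [ENNReal.tsum_comm]
        congr 1 with q
        rw [ENNReal.tsum_mul_right]
    _ ≤ D * bernsteinConst d * ∑' p : ℕ, ∑' q : ℕ,
          C₀ * ((R ^ p * a ((p : ℤ) - 1)) * (R ^ q * b ((q : ℤ) - 1))) := by
        refine mul_le_mul_right (ENNReal.tsum_le_tsum fun p => ENNReal.tsum_le_tsum fun q => ?_) _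
        calc _ ≤ (C₀ * R ^ max p q) * (R ^ min p q *
              (a ((p : ℤ) - 1) * b ((q : ℤ) - 1))) := by
              gcongr
              · exact hC _
              · exact bernsteinWeight_le_pow hs _
          _ = C₀ * (R ^ (max p q + min p q)) * (a ((p : ℤ) - 1) * b ((q : ℤ) - 1)) := by
              rw [pow_add]; ring
          _ = _ := by rw [max_add_min, pow_add]; ring
    _ = D * bernsteinConst d * (C₀ * ((R * dyadicSum s a) * (R * dyadicSum s b))) := by
        rw [e1, e2, ← ENNReal.tsum_mul_right, ← ENNReal.tsum_mul_left]
        simp_rw [ENNReal.tsum_mul_left]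
    _ = R * (bernsteinConst d * C₀ * R * D * dyadicSum s a * dyadicSum s b) := by ring

/-! ### Velocity weights and the geometry of collisions -/

lemma bracket_pos (v : Space d) : 0 < bracket v := Real.sqrt_pos.2 (by positivity)

lemma one_le_bracket (v : Space d) : 1 ≤ bracket v :=
  Real.one_le_sqrt.2 (le_add_of_nonneg_right (by positivity))

lemma bracket_sq (v : Space d) : bracket v ^ 2 = 1 + ‖v‖ ^ 2 := Real.sq_sqrt (by positivity)

lemma norm_le_bracket (v : Space d) : ‖v‖ ≤ bracket v :=
  Real.le_sqrt_of_sq_le (by linarith)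

lemma continuous_bracket : Continuous (bracket : Space d → ℝ) := by
  unfold bracket; fun_prop

lemma inner_self_sphere (ω : Sphere d) : inner ℝ (ω : Space d) (ω : Space d) = 1 := by
  rw [real_inner_self_eq_norm_sq, norm_eq_of_mem_sphere]; norm_num

/-- Conservation of energy. -/
lemma norm_sq_vPrime_add (v w : Space d) (ω : Sphere d) :
    ‖vPrime v w ω‖ ^ 2 + ‖vsPrime v w ω‖ ^ 2 = ‖v‖ ^ 2 + ‖w‖ ^ 2 := by
  have h1 := inner_self_sphere ω
  have h2 : inner ℝ (v - w) (ω : Space d) = inner ℝ v (ω : Space d) - inner ℝ w (ω : Space d) :=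
    inner_sub_left _ _ _
  rw [vPrime, vsPrime, norm_sub_sq_real, norm_add_sq_real, norm_smul, norm_eq_of_mem_sphere,
    inner_smul_right, inner_smul_right, h2, mul_one, Real.norm_eq_abs, sq_abs]
  ring

lemma bracket_le_mul (v w : Space d) (ω : Sphere d) :
    bracket v ≤ bracket (vsPrime v w ω) * bracket (vPrime v w ω) := by
  refine abs_le_of_sq_le_sq' ?_
    (by positivity [bracket_pos (vsPrime v w ω), bracket_pos (vPrime v w ω)]) |>.2
  rw [mul_pow, bracket_sq, bracket_sq, bracket_sq]
  have h := norm_sq_vPrime_add v w ω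
  nlinarith [sq_nonneg ‖w‖, mul_nonneg (sq_nonneg ‖vPrime v w ω‖) (sq_nonneg ‖vsPrime v w ω‖)]

/-- For a fixed direction, the collision map is a linear involution of the velocity pairs. -/
def collisionLinearMap (ω : Sphere d) : Space d × Space d →ₗ[ℝ] Space d × Space d where
  toFun q := (vPrime q.1 q.2 ω, vsPrime q.1 q.2 ω)
  map_add' p q := by
    ext1
    · simp only [vPrime, Prod.fst_add, Prod.snd_add, inner_sub_left, inner_add_left]; module
    · simp only [vsPrime, Prod.fst_add, Prod.snd_add, inner_sub_left, inner_add_left]; module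
  map_smul' c q := by
    ext1
    · simp only [vPrime, Prod.smul_fst, Prod.smul_snd, inner_sub_left, real_inner_smul_left,
        RingHom.id_apply]
      module
    · simp only [vsPrime, Prod.smul_fst, Prod.smul_snd, inner_sub_left, real_inner_smul_left,
        RingHom.id_apply]
      module

lemma collisionLinearMap_comp_self (ω : Sphere d) :
    collisionLinearMap ω ∘ₗ collisionLinearMap ω = LinearMap.id := by
  refine LinearMap.ext fun q => ?_
  have h1 := inner_self_sphere ω
  have h : inner ℝ (vPrime q.1 q.2 ω - vsPrime q.1 q.2 ω) (ω : Space d) =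
      -inner ℝ (q.1 - q.2) (ω : Space d) := by
    simp only [vPrime, vsPrime, inner_sub_left, inner_add_left, real_inner_smul_left, h1]
    ring
  ext1
  · change vPrime q.1 q.2 ω - inner ℝ (vPrime q.1 q.2 ω - vsPrime q.1 q.2 ω) (ω : Space d) •
      (ω : Space d) = q.1
    rw [h, vPrime]; module
  · change vsPrime q.1 q.2 ω + inner ℝ (vPrime q.1 q.2 ω - vsPrime q.1 q.2 ω) (ω : Space d) •
      (ω : Space d) = q.2
    rw [h, vsPrime]; module

lemma map_collisionLinearMap (ω : Sphere d) :
    Measure.map (collisionLinearMap ω) ((volume : Measure (Space d)).prod volume) =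
      (volume : Measure (Space d)).prod volume := by
  have hdet : LinearMap.det (collisionLinearMap ω) * LinearMap.det (collisionLinearMap ω) = 1 := by
    rw [← LinearMap.det_comp, collisionLinearMap_comp_self, LinearMap.det_id]
  have hne : LinearMap.det (collisionLinearMap ω) ≠ 0 := by
    intro h; simp [h] at hdet
  rw [Measure.map_linearMap_addHaar_eq_smul_addHaar _ hne]
  have habs : |(LinearMap.det (collisionLinearMap ω))⁻¹| = 1 := by
    rcases mul_self_eq_one_iff.1 hdet with h | h <;> simp [h]
  simp [habs]

instance : IsFiniteMeasure (surfaceMeasure d) := by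
  unfold surfaceMeasure; infer_instance

/-- The measure `dv_* dω`. -/
abbrev collisionMeasure (d : ℕ) : Measure (Space d × Sphere d) :=
  (volume : Measure (Space d)).prod (surfaceMeasure d)

-- Instance search does not find this instance through the nested product.
instance : SFinite ((volume : Measure (Space d)).prod (collisionMeasure d)) :=
  Measure.prod.instSFinite

/-- The collision map `(v, v_*, ω) ↦ (v', v'_*, ω)`. -/
def collisionMap (q : Space d × Space d × Sphere d) : Space d × Space d × Sphere d :=
  (vPrime q.1 q.2.1 q.2.2, vsPrime q.1 q.2.1 q.2.2, q.2.2)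

lemma measurePreserving_collisionMap :
    MeasurePreserving (collisionMap (d := d)) (volume.prod (collisionMeasure d))
      (volume.prod (collisionMeasure d)) := by
  have h1 : MeasurePreserving
      (fun q : Sphere d × (Space d × Space d) => (q.1, collisionLinearMap q.1 q.2))
      ((surfaceMeasure d).prod (volume.prod volume))
      ((surfaceMeasure d).prod (volume.prod volume)) := by
    refine (MeasurePreserving.id _).skew_product (g := fun ω q => collisionLinearMap ω q) ?_
      (Filter.Eventually.of_forall map_collisionLinearMap)
    have : Continuous (uncurry fun (ω : Sphere d) (q : Space d × Space d) =>
        collisionLinearMap ω q) := by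
      change Continuous fun p : Sphere d × (Space d × Space d) =>
        (vPrime p.2.1 p.2.2 p.1, vsPrime p.2.1 p.2.2 p.1)
      unfold vPrime vsPrime
      fun_prop
    exact this.measurable
  have h2 : MeasurePreserving (fun q : Space d × Space d × Sphere d => (q.2.2, (q.1, q.2.1)))
      (volume.prod (collisionMeasure d)) ((surfaceMeasure d).prod (volume.prod volume)) :=
    Measure.measurePreserving_swap.comp
      (measurePreserving_prodAssoc (volume : Measure (Space d)) volume (surfaceMeasure d)).symm
  have h3 : MeasurePreserving (fun q : Sphere d × (Space d × Space d) => (q.2.1, q.2.2, q.1))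
      ((surfaceMeasure d).prod (volume.prod volume)) (volume.prod (collisionMeasure d)) :=
    (measurePreserving_prodAssoc (volume : Measure (Space d)) volume (surfaceMeasure d)).comp
      Measure.measurePreserving_swap
  exact h3.comp (h1.comp h2)

/-! ### Velocity integrals of the collision kernel -/

lemma maxwellian_pos (v : Space d) : 0 < maxwellian v := by unfold maxwellian; positivity

lemma continuous_maxwellian : Continuous (maxwellian : Space d → ℝ) := by
  unfold maxwellian; fun_prop

/-- Conservation of energy makes `M M_*` a collision invariant. -/
lemma maxwellian_mul_prime (v w : Space d) (ω : Sphere d) :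
    maxwellian (vsPrime v w ω) * maxwellian (vPrime v w ω) = maxwellian w * maxwellian v := by
  have h := norm_sq_vPrime_add v w ω
  unfold maxwellian
  rw [mul_mul_mul_comm, mul_mul_mul_comm _ (Real.exp (-‖w‖ ^ 2 / 2)), ← Real.exp_add,
    ← Real.exp_add]
  congr 2
  linarith

/-- The Gaussian weight decays faster than any power. -/
lemma exists_sqrt_maxwellian_le {a : ℝ} (ha : 0 < a) :
    ∃ C : ℝ, 0 < C ∧ ∀ v : Space d, maxwellian v ^ (1 / 2 : ℝ) ≤ C * bracket v ^ (-a) := by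
  set K : ℝ := 1 / (2 * Real.pi) ^ ((d : ℝ) / 2) with hK
  have hK0 : 0 < K := by positivity
  refine ⟨K ^ (1 / 2 : ℝ) * ((2 * a) ^ (a / 2) * Real.exp (1 / 4)), by positivity, fun v => ?_⟩
  have hb := bracket_pos v
  have h1 : maxwellian v ^ (1 / 2 : ℝ) =
      K ^ (1 / 2 : ℝ) * (Real.exp (1 / 4) * Real.exp (-(bracket v ^ 2) / 4)) := by
    rw [maxwellian, Real.mul_rpow hK0.le (Real.exp_pos _).le, ← Real.exp_mul, ← Real.exp_add,
      bracket_sq]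
    congr 2; ring
  -- `y ≤ exp y` at `y = ⟨v⟩² / (2a)`, raised to the power `a / 2`
  have h2 : bracket v ^ a ≤ (2 * a) ^ (a / 2) * Real.exp (bracket v ^ 2 / 4) := by
    have h3 : bracket v ^ 2 / (2 * a) ≤ Real.exp (bracket v ^ 2 / (2 * a)) :=
      (by linarith : bracket v ^ 2 / (2 * a) ≤ bracket v ^ 2 / (2 * a) + 1).trans
        (Real.add_one_le_exp _)
    have h4 := Real.rpow_le_rpow (by positivity) h3 (by positivity : 0 ≤ a / 2)
    rw [Real.div_rpow (by positivity) (by positivity), ← Real.exp_mul, div_le_iff₀ (by positivity),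
      ← Real.rpow_natCast, ← Real.rpow_mul hb.le] at h4
    have e1 : ((2 : ℕ) : ℝ) * (a / 2) = a := by push_cast; ring
    have e2 : bracket v ^ ((2 : ℕ) : ℝ) / (2 * a) * (a / 2) = bracket v ^ 2 / 4 := by
      rw [Real.rpow_natCast]; field_simp; ring
    rw [e1, e2] at h4
    linarith
  rw [h1, Real.rpow_neg hb.le, mul_assoc, mul_assoc]
  refine mul_le_mul_of_nonneg_left ?_ (by positivity)
  rw [mul_comm (Real.exp (1 / 4)), neg_div, Real.exp_neg, mul_comm (Real.exp (1 / 4)), ← mul_assoc]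
  refine mul_le_mul_of_nonneg_right ?_ (Real.exp_pos _).le
  rw [← div_eq_mul_inv, inv_eq_one_div, div_le_div_iff₀ (Real.exp_pos _) (by positivity)]
  linarith

/-- Peetre's inequality. -/
lemma bracket_sub_rpow_le (γ : ℝ) (v w : Space d) :
    bracket (v - w) ^ γ ≤ 2 ^ |γ| * bracket v ^ γ * bracket w ^ |γ| := by
  have key : ∀ x y z : Space d, ‖x‖ ≤ ‖y‖ + ‖z‖ → bracket x ≤ 2 * bracket y * bracket z := by
    intro x y z h
    have hy := bracket_pos y
    have hz := bracket_pos z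
    refine (abs_le_of_sq_le_sq' ?_ (by positivity)).2
    rw [mul_pow, mul_pow, bracket_sq, bracket_sq, bracket_sq]
    have := norm_nonneg x
    nlinarith [sq_nonneg (‖y‖ - ‖z‖), mul_nonneg (sq_nonneg ‖y‖) (sq_nonneg ‖z‖), norm_nonneg y,
      norm_nonneg z]
  have h1 := bracket_pos v
  have h2 := bracket_pos w
  have h3 := bracket_pos (v - w)
  rcases le_total 0 γ with hγ | hγ
  · rw [abs_of_nonneg hγ, ← Real.mul_rpow (by positivity) h1.le,
      ← Real.mul_rpow (by positivity) h2.le]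
    exact Real.rpow_le_rpow h3.le (key _ _ _ (norm_sub_le v w)) hγ
  · have h := key v (v - w) w (by simpa using norm_add_le (v - w) w)
    have h4 := Real.rpow_le_rpow h1.le h (by linarith : 0 ≤ -γ)
    rw [Real.mul_rpow (by positivity) h2.le, Real.mul_rpow (by positivity) h3.le,
      Real.rpow_neg h1.le, Real.rpow_neg h3.le] at h4
    rw [abs_of_nonpos hγ]
    have h5 : 0 < bracket v ^ γ := by positivity
    have h6 : 0 < bracket (v - w) ^ γ := by positivity
    have h7 : (bracket v ^ γ)⁻¹ * (bracket v ^ γ * bracket (v - w) ^ γ) ≤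
        2 ^ (-γ) * (bracket (v - w) ^ γ)⁻¹ * bracket w ^ (-γ) *
          (bracket v ^ γ * bracket (v - w) ^ γ) := by gcongr
    have e1 : (bracket v ^ γ)⁻¹ * (bracket v ^ γ * bracket (v - w) ^ γ) = bracket (v - w) ^ γ := by
      field_simp
    have e2 : 2 ^ (-γ) * (bracket (v - w) ^ γ)⁻¹ * bracket w ^ (-γ) *
          (bracket v ^ γ * bracket (v - w) ^ γ) = 2 ^ (-γ) * bracket v ^ γ * bracket w ^ (-γ) := by
      field_simp
    rwa [e1, e2] at h7

lemma norm_rpow_le_bracket (γ : ℝ) (z : Space d) :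
    ‖z‖ ^ γ ≤ 2 ^ |γ| * bracket z ^ γ *
      (1 + (Metric.ball (0 : Space d) 1).indicator (fun z => ‖z‖ ^ γ) z) := by
  have hb := bracket_pos z
  have hb1 := one_le_bracket z
  have hsq := bracket_sq z
  have hz := norm_nonneg z
  by_cases h : ‖z‖ < 1
  · have hmem : z ∈ Metric.ball (0 : Space d) 1 := by simpa using h
    rw [indicator_of_mem hmem]
    have hb2 : bracket z ≤ 2 := by nlinarith
    have h1 : 1 ≤ 2 ^ |γ| * bracket z ^ γ := by
      rcases le_total 0 γ with hγ | hγ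
      · exact one_le_mul_of_one_le_of_one_le (Real.one_le_rpow one_le_two (abs_nonneg _))
          (Real.one_le_rpow hb1 hγ)
      · rw [abs_of_nonpos hγ, Real.rpow_neg two_pos.le, ← div_eq_inv_mul,
          one_le_div (by positivity)]
        exact Real.rpow_le_rpow_of_nonpos hb hb2 hγ
    have h2 : 0 ≤ ‖z‖ ^ γ := by positivity
    nlinarith
  · have hmem : z ∉ Metric.ball (0 : Space d) 1 := by simpa using h
    rw [indicator_of_notMem hmem, add_zero, mul_one]
    push Not at h
    rcases le_total 0 γ with hγ | hγ
    · calc ‖z‖ ^ γ ≤ bracket z ^ γ := Real.rpow_le_rpow hz (norm_le_bracket z) hγ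
        _ ≤ _ := le_mul_of_one_le_left (by positivity) (Real.one_le_rpow one_le_two (abs_nonneg _))
    · have h1 : bracket z ≤ 2 * ‖z‖ := by nlinarith
      have h2 := Real.rpow_le_rpow_of_nonpos hb h1 hγ
      rw [Real.mul_rpow two_pos.le hz] at h2
      rw [abs_of_nonpos hγ, Real.rpow_neg two_pos.le]
      rw [← div_eq_inv_mul, le_div_iff₀ (by positivity)]
      linarith

/-- `∫ |v - w|^γ M(w)^{1/2} dw ≤ C ⟨v⟩^γ` for `γ > -d`. -/
lemma exists_lintegral_norm_rpow_maxwellian_le (hd : 1 ≤ d) {γ : ℝ} (hγ : -(d : ℝ) < γ) :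
    ∃ C : ℝ≥0∞, C < ∞ ∧ ∀ v : Space d,
      ∫⁻ w, ENNReal.ofReal (‖v - w‖ ^ γ * maxwellian w ^ (1 / 2 : ℝ)) ≤
        C * ENNReal.ofReal (bracket v ^ γ) := by
  obtain ⟨K, hK0, hK⟩ := exists_sqrt_maxwellian_le (d := d) (a := |γ| + (d + 1)) (by positivity)
  set J : Space d → ℝ := (Metric.ball (0 : Space d) 1).indicator (fun z => ‖z‖ ^ γ) with hJ
  have hmeas : Measurable fun z : Space d => ‖z‖ ^ γ := measurable_norm.pow_const γ
  have hJm : Measurable J := hmeas.indicator measurableSet_ball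
  have hJ0 : ∀ z, 0 ≤ J z := fun z => indicator_nonneg (fun z _ => by positivity) z
  have hbm : Measurable fun w : Space d => bracket w ^ (-((d : ℝ) + 1)) :=
    continuous_bracket.measurable.pow_const _
  set I₁ : ℝ≥0∞ := ∫⁻ w : Space d, ENNReal.ofReal (bracket w ^ (-((d : ℝ) + 1))) with hI₁
  set I₂ : ℝ≥0∞ := ∫⁻ z : Space d, ENNReal.ofReal (J z) with hI₂
  have hI₁f : I₁ < ∞ := by
    have h := integrable_rpow_neg_one_add_norm_sq (E := Space d) (μ := volume)
      (r := (d : ℝ) + 1) (by simp)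
    refine lt_of_eq_of_lt (lintegral_congr fun w => ?_) h.lintegral_lt_top
    rw [← bracket_sq, ← Real.rpow_natCast, ← Real.rpow_mul (bracket_pos w).le]
    congr 2; push_cast; ring
  have hI₂f : I₂ < ∞ := by
    have h := integrableOn_ball_of_norm_le_rpow (E := Space d) (μ := volume) (r := 1) (C := 1)
      (α := -γ) (f := fun z : Space d => ‖z‖ ^ γ) (by simpa using hd) (by simp; linarith)
      (Filter.Eventually.of_forall fun z => by
        rw [neg_neg, one_mul, Real.norm_of_nonneg (by positivity)]) hmeas.aestronglyMeasurable
    exact (h.integrable_indicator measurableSet_ball).lintegral_lt_top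
  refine ⟨ENNReal.ofReal (2 ^ |γ| * 2 ^ |γ| * K) * (I₁ + I₂),
    ENNReal.mul_lt_top ENNReal.ofReal_lt_top (ENNReal.add_lt_top.2 ⟨hI₁f, hI₂f⟩), fun v => ?_⟩
  have hpt : ∀ w, ‖v - w‖ ^ γ * maxwellian w ^ (1 / 2 : ℝ) ≤
      (2 ^ |γ| * 2 ^ |γ| * K) * bracket v ^ γ * (bracket w ^ (-((d : ℝ) + 1)) + J (v - w)) := by
    intro w
    have hbw := bracket_pos w
    have hbv := bracket_pos v
    have hbz := bracket_pos (v - w)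
    have hJ1 := hJ0 (v - w)
    have h1 : bracket w ^ |γ| * bracket w ^ (-(|γ| + ((d : ℝ) + 1))) =
        bracket w ^ (-((d : ℝ) + 1)) := by
      rw [← Real.rpow_add hbw]; congr 1; ring
    have h2 : bracket w ^ (-((d : ℝ) + 1)) ≤ 1 :=
      Real.rpow_le_one_of_one_le_of_nonpos (one_le_bracket w)
        (by linarith [(Nat.cast_nonneg d : (0 : ℝ) ≤ d)])
    calc ‖v - w‖ ^ γ * maxwellian w ^ (1 / 2 : ℝ)
        ≤ (2 ^ |γ| * bracket (v - w) ^ γ * (1 + J (v - w))) *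
            (K * bracket w ^ (-(|γ| + ((d : ℝ) + 1)))) := by
          have := norm_rpow_le_bracket γ (v - w)
          have hM := hK w
          have := maxwellian_pos w
          gcongr
      _ ≤ (2 ^ |γ| * (2 ^ |γ| * bracket v ^ γ * bracket w ^ |γ|) * (1 + J (v - w))) *
            (K * bracket w ^ (-(|γ| + ((d : ℝ) + 1)))) := by
          have := bracket_sub_rpow_le γ v w
          gcongr
      _ = (2 ^ |γ| * 2 ^ |γ| * K) * bracket v ^ γ *
            ((bracket w ^ |γ| * bracket w ^ (-(|γ| + ((d : ℝ) + 1)))) * (1 + J (v - w))) := by ring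
      _ ≤ _ := by
          rw [h1]
          refine mul_le_mul_of_nonneg_left ?_ (by positivity)
          rw [mul_add, mul_one]
          gcongr
          exact mul_le_of_le_one_left hJ1 h2
  have hsub : ∫⁻ w, ENNReal.ofReal (J (v - w)) = I₂ :=
    lintegral_sub_left_eq_self (fun z => ENNReal.ofReal (J z)) v
  calc _ ≤ ∫⁻ w, ENNReal.ofReal ((2 ^ |γ| * 2 ^ |γ| * K) * bracket v ^ γ) *
        (ENNReal.ofReal (bracket w ^ (-((d : ℝ) + 1))) + ENNReal.ofReal (J (v - w))) := by
        refine lintegral_mono fun w => ?_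
        have hbw := bracket_pos w
        have hbv := bracket_pos v
        rw [← ENNReal.ofReal_add (by positivity) (hJ0 _), ← ENNReal.ofReal_mul (by positivity)]
        exact ENNReal.ofReal_le_ofReal (hpt w)
    _ = ENNReal.ofReal ((2 ^ |γ| * 2 ^ |γ| * K) * bracket v ^ γ) * (I₁ + I₂) := by
        rw [lintegral_const_mul' _ _ ENNReal.ofReal_ne_top, lintegral_add_left hbm.ennreal_ofReal,
          hsub]
    _ = _ := by
        rw [ENNReal.ofReal_mul (by positivity)]; ring

/-- The weight `B(v - v_*, ω) M(v_*)^{1/2}`. -/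
def collisionWeight (γ : ℝ) (b₀ : ℝ → ℝ) (v : Space d) (p : Space d × Sphere d) : ℝ :=
  kernel γ b₀ (v - p.1) p.2 * maxwellian p.1 ^ (1 / 2 : ℝ)

lemma inner_div_norm_mem_Icc (z : Space d) (ω : Sphere d) :
    inner ℝ (ω : Space d) z / ‖z‖ ∈ Icc (-1 : ℝ) 1 := by
  have h := abs_real_inner_le_norm (ω : Space d) z
  rw [norm_eq_of_mem_sphere, one_mul] at h
  rw [mem_Icc, ← abs_le, abs_div, abs_norm]
  exact div_le_one_of_le₀ h (norm_nonneg z)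

lemma exists_lintegral_collisionWeight_le (hd : 1 ≤ d) {γ : ℝ} (hγ : -(d : ℝ) < γ) {b₀ : ℝ → ℝ}
    (hb : ∃ C₀ : ℝ, ∀ c ∈ Set.Icc (-1 : ℝ) 1, 0 ≤ b₀ c ∧ b₀ c ≤ C₀ * |c|) :
    ∃ C : ℝ≥0∞, C < ∞ ∧ ∀ v : Space d,
      ∫⁻ p, ‖collisionWeight γ b₀ v p‖ₑ ∂(collisionMeasure d) ≤
        C * ENNReal.ofReal (bracket v ^ γ) := by
  obtain ⟨C₀, hC₀⟩ := hb
  obtain ⟨C, hC, h⟩ := exists_lintegral_norm_rpow_maxwellian_le hd hγ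
  have hC₀0 : 0 ≤ C₀ := by
    have := hC₀ 1 (by simp); simp at this; linarith
  refine ⟨ENNReal.ofReal C₀ * C * surfaceMeasure d univ, ENNReal.mul_lt_top (ENNReal.mul_lt_top
    ENNReal.ofReal_lt_top hC) (measure_lt_top _ _), fun v => ?_⟩
  have hpt : ∀ p : Space d × Sphere d, ‖collisionWeight γ b₀ v p‖ₑ ≤
      ENNReal.ofReal C₀ * ENNReal.ofReal (‖v - p.1‖ ^ γ * maxwellian p.1 ^ (1 / 2 : ℝ)) := by
    intro p
    have hc := inner_div_norm_mem_Icc (v - p.1) p.2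
    obtain ⟨h1, h2⟩ := hC₀ _ hc
    have h3 : |inner ℝ (p.2 : Space d) (v - p.1) / ‖v - p.1‖| ≤ 1 := abs_le.2 hc
    have h4 := maxwellian_pos p.1
    rw [← ENNReal.ofReal_mul hC₀0, ← ofReal_norm]
    refine ENNReal.ofReal_le_ofReal ?_
    rw [collisionWeight, kernel, Real.norm_of_nonneg (by positivity)]
    calc _ ≤ ‖v - p.1‖ ^ γ * C₀ * maxwellian p.1 ^ (1 / 2 : ℝ) := by
          gcongr
          exact h2.trans (mul_le_of_le_one_right hC₀0 h3)
      _ = _ := by ring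
  have hm : Measurable fun w : Space d =>
      ENNReal.ofReal (‖v - w‖ ^ γ * maxwellian w ^ (1 / 2 : ℝ)) := by
    have h1 : Measurable fun w : Space d => ‖v - w‖ ^ γ :=
      (measurable_const.sub measurable_id).norm.pow_const γ
    exact (h1.mul (continuous_maxwellian.measurable.pow_const _)).ennreal_ofReal
  calc _ ≤ ∫⁻ p : Space d × Sphere d, ENNReal.ofReal C₀ *
          ENNReal.ofReal (‖v - p.1‖ ^ γ * maxwellian p.1 ^ (1 / 2 : ℝ)) ∂(collisionMeasure d) :=
        lintegral_mono hpt
    _ = ENNReal.ofReal C₀ * ((∫⁻ w, ENNReal.ofReal (‖v - w‖ ^ γ * maxwellian w ^ (1 / 2 : ℝ))) *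
          surfaceMeasure d univ) := by
        rw [lintegral_const_mul' _ _ ENNReal.ofReal_ne_top]
        congr 1
        refine (lintegral_prod _ (hm.comp measurable_fst).aemeasurable).trans ?_
        simp only [Function.comp_apply, lintegral_const]
        rw [lintegral_mul_const _ hm]
    _ ≤ ENNReal.ofReal C₀ * ((C * ENNReal.ofReal (bracket v ^ γ)) * surfaceMeasure d univ) := by
        gcongr; exact h v
    _ = _ := by ring

lemma lintegral_bracket_rpow_sq_lt_top {γ β : ℝ} (hβ : γ + (d : ℝ) / 2 < β) :
    ∫⁻ v : Space d, ENNReal.ofReal (bracket v ^ (γ - β)) ^ (2 : ℝ) < ∞ := by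
  have h := integrable_rpow_neg_one_add_norm_sq (E := Space d) (μ := volume)
    (r := 2 * (β - γ)) (by simp; linarith)
  refine lt_of_eq_of_lt (lintegral_congr fun v => ?_) h.lintegral_lt_top
  have hb := bracket_pos v
  rw [← bracket_sq, ENNReal.ofReal_rpow_of_nonneg (by positivity) (by norm_num),
    ← Real.rpow_natCast, ← Real.rpow_mul hb.le, ← Real.rpow_mul hb.le]
  congr 2; push_cast; ring

/-! ### Products at two fixed velocities -/

lemma productBound_mul_le (n : ℕ) {a a' b b' : ℕ → ℝ≥0∞} {r t : ℝ≥0∞} (ha : ∀ p, a p ≤ r * a' p)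
    (hb : ∀ q, b q ≤ t * b' q) : productBound d n a b ≤ r * t * productBound d n a' b' := by
  have hcomm : ∀ X, r * t * (bernsteinConst d * X) = bernsteinConst d * (r * t * X) :=
    fun X => by ring
  rw [productBound, productBound, hcomm]
  refine mul_le_mul_right ?_ _
  rw [← ENNReal.tsum_mul_left]
  refine ENNReal.tsum_le_tsum fun p => ?_
  rw [← ENNReal.tsum_mul_left]
  refine ENNReal.tsum_le_tsum fun q => ?_
  split_ifs
  · calc _ ≤ bernsteinWeight d (min p q) * ((r * a' p) * (t * b' q)) := by
          gcongr
          · exact ha p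
          · exact hb q
      _ = _ := by ring
  · simp

/-- The transpose of the block `Δ_{n-1}` applied to a test function `ψ`: by definition,
`(Δ_{n-1} u) ψ = u (blockTest n ψ)`. -/
def LittlewoodPaley.blockTest (L : LittlewoodPaley d) (n : ℕ) (ψ : 𝓢(Space d, ℂ)) :
    𝓢(Space d, ℂ) :=
  𝓕 (SchwartzMap.smulLeftCLM ℂ (fun ξ => (L.sym n ξ : ℂ)) (𝓕⁻ ψ))

/-- The dyadic norms of `h` are at most `r a_n`. -/
def LittlewoodPaley.BlockBound (L : LittlewoodPaley d) (h : Space d → ℂ) (r : ℝ≥0∞)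
    (a : ℕ → ℝ≥0∞) : Prop :=
  ∀ n : ℕ, L.blockNorm ((n : ℤ) - 1) h ≤ r * a n

lemma LittlewoodPaley.BlockBound.exists_fourierDensity {L : LittlewoodPaley d} {h : Space d → ℂ}
    {r : ℝ≥0∞} {a : ℕ → ℝ≥0∞} (hh : L.BlockBound h r a) (hr : r < ∞)
    (ha : ∑' n, bernsteinWeight d n * a n < ∞) :
    ∃ F : Space d → ℂ, Integrable F ∧ h =ᵐ[volume] 𝓕⁻ F ∧
      (∀ n : ℕ, eLpNorm (fun ξ => (L.sym n ξ : ℂ) * F ξ) 2 volume ≤ r * a n) ∧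
      ∫⁻ ξ, ‖F ξ‖ₑ ≤ r * (bernsteinConst d * ∑' n, bernsteinWeight d n * a n) := by
  have hle : ∑' n : ℕ, bernsteinWeight d n * L.blockNorm ((n : ℤ) - 1) h ≤
      r * ∑' n, bernsteinWeight d n * a n := by
    rw [← ENNReal.tsum_mul_left]
    refine ENNReal.tsum_le_tsum fun n => ?_
    calc _ ≤ bernsteinWeight d n * (r * a n) := by gcongr; exact hh n
      _ = _ := by ring
  obtain ⟨F, hF, hhF, hn⟩ := L.exists_fourierDensity (hle.trans_lt (ENNReal.mul_lt_top hr ha))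
  refine ⟨F, hF, hhF, fun n => (hn n).le.trans (hh n), (L.lintegral_enorm_le hF.1).trans ?_⟩
  simp_rw [hn]
  calc _ ≤ bernsteinConst d * (r * ∑' n, bernsteinWeight d n * a n) := by gcongr
    _ = _ := by ring

/-- The embedding of the Besov space into the bounded functions. -/
lemma LittlewoodPaley.BlockBound.ae_enorm_le {L : LittlewoodPaley d} {h : Space d → ℂ}
    {r : ℝ≥0∞} {a : ℕ → ℝ≥0∞} (hh : L.BlockBound h r a) (hr : r < ∞)
    (ha : ∑' n, bernsteinWeight d n * a n < ∞) :
    ∀ᵐ x, ‖h x‖ₑ ≤ r * (bernsteinConst d * ∑' n, bernsteinWeight d n * a n) := by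
  obtain ⟨F, hF, hhF, -, hle⟩ := hh.exists_fourierDensity hr ha
  filter_upwards [hhF] with x hx
  rw [hx]
  refine le_trans ?_ hle
  rw [← ofReal_norm, ← ofReal_integral_norm_eq_lintegral_enorm hF]
  exact ENNReal.ofReal_le_ofReal (norm_fourierInv_le F x)

/-- The block `Δ_{n-1}` of a product of two functions with bounded dyadic norms, tested against
`ψ`. -/
lemma LittlewoodPaley.BlockBound.mul {L : LittlewoodPaley d} {h k : Space d → ℂ}
    {r t : ℝ≥0∞} {a b : ℕ → ℝ≥0∞} (hh : L.BlockBound h r a) (hk : L.BlockBound k t b)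
    (hr : r < ∞) (ht : t < ∞) (ha : ∑' n, bernsteinWeight d n * a n < ∞)
    (hb : ∑' n, bernsteinWeight d n * b n < ∞) (n : ℕ) (ψ : 𝓢(Space d, ℂ)) :
    Integrable (fun x => (h x * k x) * L.blockTest n ψ x) ∧
      ‖∫ x, (h x * k x) * L.blockTest n ψ x‖ₑ ≤ r * t * productBound d n a b * ‖ψ.toLp 2‖ₑ := by
  obtain ⟨F, hF, hhF, hFn, -⟩ := hh.exists_fourierDensity hr ha
  obtain ⟨G, hG, hkG, hGn, -⟩ := hk.exists_fourierDensity ht hb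
  have hae : (fun x => (h x * k x) * L.blockTest n ψ x) =ᵐ[volume]
      fun x => (𝓕⁻ F x * 𝓕⁻ G x) * L.blockTest n ψ x := by
    filter_upwards [hhF, hkG] with x h1 h2
    rw [h1, h2]
  constructor
  · refine Integrable.congr ?_ hae.symm
    refine (L.blockTest n ψ).integrable.bdd_mul (c := (∫ ξ, ‖F ξ‖) * ∫ ξ, ‖G ξ‖)
      ((continuous_fourierInv hF).mul (continuous_fourierInv hG)).aestronglyMeasurable
      (Filter.Eventually.of_forall fun x => ?_)
    rw [norm_mul]
    exact mul_le_mul (norm_fourierInv_le F x) (norm_fourierInv_le G x) (norm_nonneg _)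
      (integral_nonneg fun _ => norm_nonneg _)
  · rw [integral_congr_ae hae]
    refine (L.enorm_integral_mul_block_le n hF hG (𝓕⁻ ψ)).trans ?_
    have hψ : ‖(𝓕⁻ ψ).toLp 2‖ₑ = ‖ψ.toLp 2‖ₑ := by
      rw [← ofReal_norm, ← ofReal_norm, ← SchwartzMap.norm_fourier_toL2_eq (𝓕⁻ ψ),
        fourier_fourierInv_eq]
    rw [hψ]
    gcongr
    exact productBound_mul_le n hFn hGn

/-! ### The collision integrand -/

/-- The integrand of `Γ(f, g)(x, v)` after the Maxwellians have been cancelled. -/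
def gammaIntegrand (γ : ℝ) (b₀ : ℝ → ℝ) (f g : Space d → Space d → ℂ) (x v : Space d)
    (p : Space d × Sphere d) : ℂ :=
  (collisionWeight γ b₀ v p : ℂ) *
    (f x (vsPrime v p.1 p.2) * g x (vPrime v p.1 p.2) - f x p.1 * g x v)

lemma collisionIntegrand_eq (γ : ℝ) (b₀ : ℝ → ℝ) (f g : Space d → Space d → ℂ) (x v : Space d)
    (p : Space d × Sphere d) :
    collisionIntegrand γ b₀ (sqrtMaxwellianMul f x) (sqrtMaxwellianMul g x) v p =
      ((maxwellian v ^ (1 / 2 : ℝ) : ℝ) : ℂ) * gammaIntegrand γ b₀ f g x v p := by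
  have h : (((maxwellian (vsPrime v p.1 p.2) ^ (1 / 2 : ℝ) : ℝ) : ℂ)) *
      ((maxwellian (vPrime v p.1 p.2) ^ (1 / 2 : ℝ) : ℝ) : ℂ) =
      ((maxwellian p.1 ^ (1 / 2 : ℝ) : ℝ) : ℂ) * ((maxwellian v ^ (1 / 2 : ℝ) : ℝ) : ℂ) := by
    rw [← Complex.ofReal_mul, ← Complex.ofReal_mul,
      ← Real.mul_rpow (maxwellian_pos _).le (maxwellian_pos _).le, maxwellian_mul_prime,
      Real.mul_rpow (maxwellian_pos _).le (maxwellian_pos _).le]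
  simp only [collisionIntegrand, sqrtMaxwellianMul, gammaIntegrand, collisionWeight,
    Complex.ofReal_mul]
  linear_combination (kernel γ b₀ (v - p.1) p.2 : ℂ) * f x (vsPrime v p.1 p.2) *
    g x (vPrime v p.1 p.2) * h

lemma Gamma_eq_integral (γ : ℝ) (b₀ : ℝ → ℝ) (f g : Space d → Space d → ℂ) (x v : Space d) :
    Gamma γ b₀ f g x v = ∫ p, gammaIntegrand γ b₀ f g x v p ∂(collisionMeasure d) := by
  have h := maxwellian_pos v
  rw [Gamma, collisionQ]
  simp_rw [collisionIntegrand_eq]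
  rw [integral_const_mul, ← mul_assoc, ← Complex.ofReal_mul, ← Real.rpow_add h]
  simp

lemma measurable_collisionWeight (γ : ℝ) {b₀ : ℝ → ℝ} (hb : Measurable b₀) :
    Measurable (uncurry (collisionWeight (d := d) γ b₀)) := by
  unfold collisionWeight kernel uncurry
  have h1 : Measurable fun q : Space d × Space d × Sphere d => q.1 - q.2.1 := by fun_prop
  have h2 : Measurable fun q : Space d × Space d × Sphere d =>
      inner ℝ (q.2.2 : Space d) (q.1 - q.2.1) := by
    have : Continuous fun q : Space d × Space d × Sphere d =>
        inner ℝ (q.2.2 : Space d) (q.1 - q.2.1) := by fun_prop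
    exact this.measurable
  exact ((h1.norm.pow_const γ).mul (hb.comp (h2.div h1.norm))).mul
    ((continuous_maxwellian.measurable.comp (measurable_fst.comp measurable_snd)).pow_const _)

lemma quasiMeasurePreserving_vPrime :
    Measure.QuasiMeasurePreserving
      (fun q : Space d × Space d × Sphere d => vPrime q.1 q.2.1 q.2.2)
      (volume.prod (collisionMeasure d)) volume :=
  MeasureTheory.QuasiMeasurePreserving.fst
    measurePreserving_collisionMap.quasiMeasurePreserving

lemma quasiMeasurePreserving_vsPrime :
    Measure.QuasiMeasurePreserving
      (fun q : Space d × Space d × Sphere d => vsPrime q.1 q.2.1 q.2.2)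
      (volume.prod (collisionMeasure d)) volume :=
  MeasureTheory.QuasiMeasurePreserving.fst (MeasureTheory.QuasiMeasurePreserving.snd
    measurePreserving_collisionMap.quasiMeasurePreserving)

lemma quasiMeasurePreserving_vs :
    Measure.QuasiMeasurePreserving (fun q : Space d × Space d × Sphere d => q.2.1)
      (volume.prod (collisionMeasure d)) volume :=
  MeasureTheory.QuasiMeasurePreserving.fst Measure.quasiMeasurePreserving_snd

lemma quasiMeasurePreserving_v :
    Measure.QuasiMeasurePreserving (fun q : Space d × Space d × Sphere d => q.1)
      (volume.prod (collisionMeasure d)) volume :=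
  Measure.quasiMeasurePreserving_fst

lemma aestronglyMeasurable_comp_velocity {f : Space d → Space d → ℂ}
    (hf : AEStronglyMeasurable (uncurry f) (volume.prod volume))
    {π : Space d × Space d × Sphere d → Space d}
    (hπ : Measure.QuasiMeasurePreserving π (volume.prod (collisionMeasure d)) volume) :
    AEStronglyMeasurable (fun q : Space d × (Space d × Space d × Sphere d) => f q.1 (π q.2))
      (volume.prod (volume.prod (collisionMeasure d))) :=
  hf.comp_quasiMeasurePreserving
    (MeasureTheory.QuasiMeasurePreserving.prodMap
      (Measure.QuasiMeasurePreserving.id (volume : Measure (Space d))) hπ)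

lemma aestronglyMeasurable_gammaIntegrand (γ : ℝ) {b₀ : ℝ → ℝ} (hb : Measurable b₀)
    {f g : Space d → Space d → ℂ} (hf : AEStronglyMeasurable (uncurry f) (volume.prod volume))
    (hg : AEStronglyMeasurable (uncurry g) (volume.prod volume)) :
    AEStronglyMeasurable (fun q : Space d × (Space d × Space d × Sphere d) =>
      gammaIntegrand γ b₀ f g q.1 q.2.1 q.2.2)
      (volume.prod (volume.prod (collisionMeasure d))) := by
  have h1 : Measurable fun q : Space d × (Space d × Space d × Sphere d) =>
      (collisionWeight γ b₀ q.2.1 q.2.2 : ℂ) :=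
    Complex.measurable_ofReal.comp ((measurable_collisionWeight γ hb).comp measurable_snd)
  refine h1.aestronglyMeasurable.mul ?_
  exact ((aestronglyMeasurable_comp_velocity hf quasiMeasurePreserving_vsPrime).mul
    (aestronglyMeasurable_comp_velocity hg quasiMeasurePreserving_vPrime)).sub
    ((aestronglyMeasurable_comp_velocity hf quasiMeasurePreserving_vs).mul
      (aestronglyMeasurable_comp_velocity hg quasiMeasurePreserving_v))

/-- A pointwise bound on almost every slice holds almost everywhere; the measurability of `f` cannot
be dropped here. -/
lemma ae_prod_enorm_le {f : Space d → Space d → ℂ}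
    (hf : AEStronglyMeasurable (uncurry f) (volume.prod volume)) {w : Space d → ℝ≥0∞}
    (hw : Measurable w) (h : ∀ᵐ v, ∀ᵐ x, ‖f x v‖ₑ ≤ w v) :
    ∀ᵐ q : Space d × Space d ∂(volume.prod volume), ‖f q.1 q.2‖ₑ ≤ w q.2 := by
  have hm : AEMeasurable (fun q : Space d × Space d => ‖f q.1 q.2‖ₑ - w q.2)
      (volume.prod volume) := hf.enorm.sub (hw.comp measurable_snd).aemeasurable
  have h0 : ∫⁻ q : Space d × Space d, (‖f q.1 q.2‖ₑ - w q.2) ∂(volume.prod volume) = 0 := by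
    rw [lintegral_prod_symm _ hm]
    refine (lintegral_congr_ae (g := fun _ => 0) ?_).trans lintegral_zero
    filter_upwards [h] with v hv
    refine (lintegral_congr_ae (g := fun _ => 0) ?_).trans lintegral_zero
    filter_upwards [hv] with x hx using tsub_eq_zero_of_le hx
  rw [lintegral_eq_zero_iff' hm] at h0
  filter_upwards [h0] with q hq using tsub_eq_zero_iff_le.1 hq

/-! ### Dyadic blocks of functions given by an integral -/

/-- A bound for the blocks of `x ↦ ∫ k(x, p) dμ(p)` by duality and Fubini's theorem. The bound `w`
only serves to make the integrals absolutely convergent. -/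
lemma LittlewoodPaley.blockNorm_integral_le (L : LittlewoodPaley d) {Ω : Type*}
    [MeasurableSpace Ω] {μ : Measure Ω} [SFinite μ] {k : Space d → Ω → ℂ}
    (hk : AEStronglyMeasurable (uncurry k) (volume.prod μ)) {w w' : Ω → ℝ≥0∞}
    (hw : AEMeasurable w μ) (hw_lt : ∫⁻ p, w p ∂μ < ∞)
    (hkw : ∀ᵐ z ∂volume.prod μ, ‖k z.1 z.2‖ₑ ≤ w z.2) (n : ℕ)
    (hkw' : ∀ᵐ p ∂μ, ∀ ψ : 𝓢(Space d, ℂ),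
      ‖∫ x, k x p * L.blockTest n ψ x‖ₑ ≤ w' p * ‖ψ.toLp 2‖ₑ) :
    L.blockNorm ((n : ℤ) - 1) (fun x => ∫ p, k x p ∂μ) ≤ ∫⁻ p, w' p ∂μ := by
  rcases eq_or_ne (∫⁻ p, w' p ∂μ) ∞ with htop | htop
  · rw [htop]; exact le_top
  have hint : ∀ θ : 𝓢(Space d, ℂ),
      Integrable (uncurry fun x p => k x p * θ x) (volume.prod μ) := by
    intro θ
    have hθm : AEStronglyMeasurable (fun z : Space d × Ω => θ z.1) (volume.prod μ) :=
      (θ.continuous.measurable.comp measurable_fst).aestronglyMeasurable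
    refine ⟨hk.mul hθm, ?_⟩
    calc ∫⁻ z, ‖k z.1 z.2 * θ z.1‖ₑ ∂(volume.prod μ)
        ≤ ∫⁻ z : Space d × Ω, ‖θ z.1‖ₑ * w z.2 ∂(volume.prod μ) := by
          refine lintegral_mono_ae ?_
          filter_upwards [hkw] with z hz
          rw [enorm_mul, mul_comm]
          gcongr
      _ = (∫⁻ x, ‖θ x‖ₑ) * ∫⁻ p, w p ∂μ :=
          lintegral_prod_mul θ.continuous.enorm.measurable.aemeasurable hw
      _ < ∞ := ENNReal.mul_lt_top θ.integrable.hasFiniteIntegral hw_lt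
  have hm : AEStronglyMeasurable (fun x => ∫ p, k x p ∂μ) volume := hk.integral_prod_right'
  have hbd : ∀ᵐ x, ‖∫ p, k x p ∂μ‖ ≤ (∫⁻ p, w p ∂μ).toReal := by
    filter_upwards [Measure.ae_ae_of_ae_prod hkw] with x hx
    rw [← toReal_enorm]
    exact ENNReal.toReal_mono hw_lt.ne
      ((enorm_integral_le_lintegral_enorm _).trans (lintegral_mono_ae hx))
  obtain ⟨u, hu⟩ := isRegular_of_bounded hm hbd
  rw [hu.blockNorm_eq, ← ENNReal.ofReal_toReal htop]
  refine l2Norm_le_of_forall ENNReal.toReal_nonneg fun ψ => ?_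
  have hswap : L.block ((n : ℤ) - 1) u ψ = ∫ p, (∫ x, k x p * L.blockTest n ψ x) ∂μ := by
    change u (L.blockTest n ψ) = _
    rw [(hu.2 _).2, ← integral_integral_swap (hint _)]
    refine integral_congr_ae (Filter.Eventually.of_forall fun x => ?_)
    simp only [smul_eq_mul]
    rw [integral_mul_const, mul_comm]
  have hle : ‖L.block ((n : ℤ) - 1) u ψ‖ₑ ≤ (∫⁻ p, w' p ∂μ) * ‖ψ.toLp 2‖ₑ := by
    rw [hswap, ← lintegral_mul_const' _ _ enorm_ne_top]
    refine (enorm_integral_le_lintegral_enorm _).trans (lintegral_mono_ae ?_)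
    filter_upwards [hkw'] with p hp using hp ψ
  rw [← toReal_enorm (L.block _ u ψ), ← toReal_enorm (ψ.toLp 2 volume), ← ENNReal.toReal_mul]
  exact ENNReal.toReal_mono (ENNReal.mul_ne_top htop enorm_ne_top) hle

/-! ### Functions in the weighted Chemin-Lerner space -/

/-- `sup_v ⟨v⟩^β ‖Δ_{n-1} f(·, v)‖_{L²_x}`, with the essential supremum. -/
def LittlewoodPaley.supBlock (L : LittlewoodPaley d) (β : ℝ) (f : Space d → Space d → ℂ)
    (n : ℕ) : ℝ≥0∞ :=
  essSup (fun v => ENNReal.ofReal (bracket v ^ β) *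
    L.blockNorm ((n : ℤ) - 1) (fun x => f x v)) volume

lemma LittlewoodPaley.ae_blockBound (L : LittlewoodPaley d) (β : ℝ) (f : Space d → Space d → ℂ) :
    ∀ᵐ v, L.BlockBound (fun x => f x v) (ENNReal.ofReal (bracket v ^ (-β))) (L.supBlock β f) := by
  refine ae_all_iff.2 fun n => ?_
  filter_upwards [ENNReal.ae_le_essSup (μ := volume) fun v : Space d =>
    ENNReal.ofReal (bracket v ^ β) * L.blockNorm ((n : ℤ) - 1) (fun x => f x v)] with v hv
  have hb := bracket_pos v
  calc L.blockNorm ((n : ℤ) - 1) (fun x => f x v)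
      = ENNReal.ofReal (bracket v ^ (-β)) * (ENNReal.ofReal (bracket v ^ β) *
          L.blockNorm ((n : ℤ) - 1) (fun x => f x v)) := by
        rw [← mul_assoc, ← ENNReal.ofReal_mul (by positivity), ← Real.rpow_add hb]
        simp
    _ ≤ _ := by gcongr; exact hv

lemma LittlewoodPaley.MemLinfty.tsum_supBlock_lt_top {L : LittlewoodPaley d} {s β : ℝ}
    {f : Space d → Space d → ℂ} (hf : L.MemLinfty s β f) (hs : (d : ℝ) / 2 ≤ s) :
    ∑' n, bernsteinWeight d n * L.supBlock β f n < ∞ :=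
  (tsum_bernsteinWeight_le hs fun j => essSup (fun v => ENNReal.ofReal (bracket v ^ β) *
    L.blockNorm j (fun x => f x v)) volume).trans_lt
    (ENNReal.mul_lt_top ENNReal.ofReal_lt_top hf.2)

/-- A bound for `⟨v⟩^β |f(x, v)|`, by the embedding of the Besov space into `L^∞_x`. -/
def LittlewoodPaley.supBound (L : LittlewoodPaley d) (β : ℝ) (f : Space d → Space d → ℂ) : ℝ≥0∞ :=
  bernsteinConst d * ∑' n, bernsteinWeight d n * L.supBlock β f n

lemma LittlewoodPaley.MemLinfty.supBound_lt_top {L : LittlewoodPaley d} {s β : ℝ}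
    {f : Space d → Space d → ℂ} (hf : L.MemLinfty s β f) (hs : (d : ℝ) / 2 ≤ s) :
    L.supBound β f < ∞ :=
  ENNReal.mul_lt_top (bernsteinConst_lt_top d) (hf.tsum_supBlock_lt_top hs)

lemma LittlewoodPaley.MemLinfty.ae_enorm_le {L : LittlewoodPaley d} {s β : ℝ}
    {f : Space d → Space d → ℂ} (hf : L.MemLinfty s β f) (hs : (d : ℝ) / 2 ≤ s) :
    ∀ᵐ q : Space d × Space d ∂(volume.prod volume),
      ‖f q.1 q.2‖ₑ ≤ ENNReal.ofReal (bracket q.2 ^ (-β)) * L.supBound β f := by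
  refine ae_prod_enorm_le hf.1 (w := fun v => ENNReal.ofReal (bracket v ^ (-β)) * L.supBound β f)
    ((continuous_bracket.measurable.pow_const _).ennreal_ofReal.mul_const _) ?_
  filter_upwards [L.ae_blockBound β f] with v hv
  exact hv.ae_enorm_le ENNReal.ofReal_lt_top (hf.tsum_supBlock_lt_top hs)

/-! ### Bounds for the collision integrand -/

/-- The weights at the velocities after a collision control the weight at `v`, because
`⟨v⟩ ≤ ⟨v'_*⟩ ⟨v'⟩`. -/
lemma ofReal_bracket_prime_mul_le {β : ℝ} (hβ : 0 ≤ β) (v w : Space d) (ω : Sphere d) :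
    ENNReal.ofReal (bracket (vsPrime v w ω) ^ (-β)) *
      ENNReal.ofReal (bracket (vPrime v w ω) ^ (-β)) ≤ ENNReal.ofReal (bracket v ^ (-β)) := by
  have h1 := bracket_pos (vsPrime v w ω)
  have h2 := bracket_pos (vPrime v w ω)
  rw [← ENNReal.ofReal_mul (by positivity), ← Real.mul_rpow h1.le h2.le]
  exact ENNReal.ofReal_le_ofReal
    (Real.rpow_le_rpow_of_nonpos (bracket_pos v) (bracket_le_mul v w ω) (by linarith))

lemma ofReal_bracket_mul_le {β : ℝ} (hβ : 0 ≤ β) (v w : Space d) :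
    ENNReal.ofReal (bracket w ^ (-β)) * ENNReal.ofReal (bracket v ^ (-β)) ≤
      ENNReal.ofReal (bracket v ^ (-β)) := by
  refine mul_le_of_le_one_left' ?_
  rw [← ENNReal.ofReal_one]
  exact ENNReal.ofReal_le_ofReal
    (Real.rpow_le_one_of_one_le_of_nonpos (one_le_bracket w) (by linarith))

/-- A bound for the sum of the gain and the loss, uniform in the collision parameters. -/
lemma gain_add_loss_le {β : ℝ} (hβ : 0 ≤ β) (v w : Space d) (ω : Sphere d) (K : ℝ≥0∞) :
    ENNReal.ofReal (bracket (vsPrime v w ω) ^ (-β)) *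
        ENNReal.ofReal (bracket (vPrime v w ω) ^ (-β)) * K +
      ENNReal.ofReal (bracket w ^ (-β)) * ENNReal.ofReal (bracket v ^ (-β)) * K ≤
      2 * ENNReal.ofReal (bracket v ^ (-β)) * K := by
  calc _ ≤ ENNReal.ofReal (bracket v ^ (-β)) * K + ENNReal.ofReal (bracket v ^ (-β)) * K := by
        gcongr
        · exact ofReal_bracket_prime_mul_le hβ v w ω
        · exact ofReal_bracket_mul_le hβ v w
    _ = _ := by ring

lemma ae_comp_velocity {P : Space d × Space d → Prop}
    (hP : ∀ᵐ q : Space d × Space d ∂(volume.prod volume), P q)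
    {π : Space d × Space d × Sphere d → Space d}
    (hπ : Measure.QuasiMeasurePreserving π (volume.prod (collisionMeasure d)) volume) :
    ∀ᵐ q : Space d × (Space d × Space d × Sphere d)
      ∂(volume.prod (volume.prod (collisionMeasure d))), P (q.1, π q.2) :=
  (MeasureTheory.QuasiMeasurePreserving.prodMap
    (Measure.QuasiMeasurePreserving.id (volume : Measure (Space d))) hπ).ae hP

lemma ae_enorm_gammaIntegrand_le {L : LittlewoodPaley d} {s β : ℝ} (γ : ℝ) (b₀ : ℝ → ℝ)
    {f g : Space d → Space d → ℂ} (hf : L.MemLinfty s β f) (hg : L.MemLinfty s β g)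
    (hs : (d : ℝ) / 2 ≤ s) (hβ : 0 ≤ β) :
    ∀ᵐ q : Space d × (Space d × Space d × Sphere d)
      ∂(volume.prod (volume.prod (collisionMeasure d))),
      ‖gammaIntegrand γ b₀ f g q.1 q.2.1 q.2.2‖ₑ ≤ ‖collisionWeight γ b₀ q.2.1 q.2.2‖ₑ *
        (2 * ENNReal.ofReal (bracket q.2.1 ^ (-β)) * (L.supBound β f * L.supBound β g)) := by
  filter_upwards [ae_comp_velocity (hf.ae_enorm_le hs) quasiMeasurePreserving_vsPrime,
    ae_comp_velocity (hg.ae_enorm_le hs) quasiMeasurePreserving_vPrime,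
    ae_comp_velocity (hf.ae_enorm_le hs) quasiMeasurePreserving_vs,
    ae_comp_velocity (hg.ae_enorm_le hs) quasiMeasurePreserving_v] with q h1 h2 h3 h4
  have hc : ‖(collisionWeight γ b₀ q.2.1 q.2.2 : ℂ)‖ₑ = ‖collisionWeight γ b₀ q.2.1 q.2.2‖ₑ := by
    rw [← ofReal_norm, ← ofReal_norm, Complex.norm_real]
  rw [gammaIntegrand, enorm_mul, hc]
  refine mul_le_mul_right ((enorm_sub_le).trans (le_trans ?_
    (gain_add_loss_le hβ q.2.1 q.2.2.1 q.2.2.2 _))) _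
  rw [enorm_mul, enorm_mul]
  refine add_le_add ((mul_le_mul' h1 h2).trans_eq ?_) ((mul_le_mul' h3 h4).trans_eq ?_) <;> ring

lemma measurePreserving_prodRotate :
    MeasurePreserving
      (fun q : Space d × (Space d × (Space d × Sphere d)) => (q.2.1, (q.1, q.2.2)))
      (volume.prod (volume.prod (collisionMeasure d)))
      (volume.prod (volume.prod (collisionMeasure d))) :=
  (measurePreserving_prodAssoc (volume : Measure (Space d)) volume (collisionMeasure d)).comp
    ((Measure.measurePreserving_swap.prod (MeasurePreserving.id _)).comp
      (measurePreserving_prodAssoc (volume : Measure (Space d)) volume (collisionMeasure d)).symm)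

lemma lintegral_gamma_bound_lt_top {γ : ℝ} {b₀ : ℝ → ℝ} {C : ℝ≥0∞} (hC : C < ∞)
    (h : ∀ v : Space d, ∫⁻ p, ‖collisionWeight γ b₀ v p‖ₑ ∂(collisionMeasure d) ≤
      C * ENNReal.ofReal (bracket v ^ γ)) (v : Space d) {R : ℝ≥0∞} (hR : R < ∞) :
    ∫⁻ p, ‖collisionWeight γ b₀ v p‖ₑ * R ∂(collisionMeasure d) < ∞ := by
  rw [lintegral_mul_const' _ _ hR.ne]
  exact ENNReal.mul_lt_top ((h v).trans_lt (ENNReal.mul_lt_top hC ENNReal.ofReal_lt_top)) hR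

/-! ### The bilinear estimate -/

lemma gammaConverges {L : LittlewoodPaley d} {s β γ : ℝ} {b₀ : ℝ → ℝ} (hd : 1 ≤ d)
    (hγ : -(d : ℝ) < γ) (hb_meas : Measurable b₀)
    (hb : ∃ C₀ : ℝ, ∀ c ∈ Set.Icc (-1 : ℝ) 1, 0 ≤ b₀ c ∧ b₀ c ≤ C₀ * |c|)
    {f g : Space d → Space d → ℂ} (hf : L.MemLinfty s β f) (hg : L.MemLinfty s β g)
    (hs : (d : ℝ) / 2 ≤ s) (hβ : 0 ≤ β) : GammaConverges γ b₀ f g := by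
  obtain ⟨C, hC, hCw⟩ := exists_lintegral_collisionWeight_le hd hγ hb
  have hassoc := measurePreserving_prodAssoc (volume : Measure (Space d)) (volume : Measure (Space d))
    (collisionMeasure d)
  have hm := ((aestronglyMeasurable_gammaIntegrand γ hb_meas hf.1 hg.1).comp_measurePreserving
    hassoc).prodMk_left
  have hbd := Measure.ae_ae_of_ae_prod (hassoc.quasiMeasurePreserving.ae
    (ae_enorm_gammaIntegrand_le γ b₀ hf hg hs hβ))
  filter_upwards [hm, hbd] with q hq1 hq2
  simp_rw [funext (collisionIntegrand_eq γ b₀ f g q.1 q.2)]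
  refine Integrable.const_mul ⟨hq1, (lintegral_mono_ae hq2).trans_lt ?_⟩ _
  have hR : 2 * ENNReal.ofReal (bracket q.2 ^ (-β)) * (L.supBound β f * L.supBound β g) < ∞ :=
    ENNReal.mul_lt_top (ENNReal.mul_lt_top (ENNReal.ofNat_lt_top (n := 2)) ENNReal.ofReal_lt_top)
      (ENNReal.mul_lt_top (hf.supBound_lt_top hs) (hg.supBound_lt_top hs))
  exact lintegral_gamma_bound_lt_top hC hCw q.2 hR

lemma aestronglyMeasurable_Gamma (γ : ℝ) {b₀ : ℝ → ℝ} (hb : Measurable b₀)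
    {f g : Space d → Space d → ℂ} (hf : AEStronglyMeasurable (uncurry f) (volume.prod volume))
    (hg : AEStronglyMeasurable (uncurry g) (volume.prod volume)) :
    AEStronglyMeasurable (uncurry (Gamma γ b₀ f g)) (volume.prod volume) := by
  have hassoc := measurePreserving_prodAssoc (volume : Measure (Space d)) (volume : Measure (Space d))
    (collisionMeasure d)
  have h := ((aestronglyMeasurable_gammaIntegrand γ hb hf hg).comp_measurePreserving
    hassoc).integral_prod_right'
  refine h.congr (Filter.Eventually.of_forall fun q => ?_)
  exact (Gamma_eq_integral γ b₀ f g q.1 q.2).symm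

/-- The Besov product estimate, applied to the gain and to the loss for fixed velocities. -/
lemma ae_enorm_integral_gammaIntegrand_mul_le {L : LittlewoodPaley d} {s β : ℝ} (γ : ℝ)
    (b₀ : ℝ → ℝ) {f g : Space d → Space d → ℂ} (hf : L.MemLinfty s β f)
    (hg : L.MemLinfty s β g) (hs : (d : ℝ) / 2 ≤ s) (hβ : 0 ≤ β) :
    ∀ᵐ q : Space d × Space d × Sphere d ∂(volume.prod (collisionMeasure d)),
      ∀ (n : ℕ) (ψ : 𝓢(Space d, ℂ)),
        ‖∫ x, gammaIntegrand γ b₀ f g x q.1 q.2 * L.blockTest n ψ x‖ₑ ≤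
          ‖collisionWeight γ b₀ q.1 q.2‖ₑ * (2 * ENNReal.ofReal (bracket q.1 ^ (-β)) *
            productBound d n (L.supBlock β f) (L.supBlock β g)) * ‖ψ.toLp 2‖ₑ := by
  filter_upwards [quasiMeasurePreserving_vsPrime.ae (L.ae_blockBound β f),
    quasiMeasurePreserving_vPrime.ae (L.ae_blockBound β g),
    quasiMeasurePreserving_vs.ae (L.ae_blockBound β f),
    quasiMeasurePreserving_v.ae (L.ae_blockBound β g)] with q h1 h2 h3 h4 n ψ
  have hF := hf.tsum_supBlock_lt_top hs
  have hG := hg.tsum_supBlock_lt_top hs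
  obtain ⟨i1, e1⟩ := h1.mul h2 ENNReal.ofReal_lt_top ENNReal.ofReal_lt_top hF hG n ψ
  obtain ⟨i2, e2⟩ := h3.mul h4 ENNReal.ofReal_lt_top ENNReal.ofReal_lt_top hF hG n ψ
  have hc : ‖(collisionWeight γ b₀ q.1 q.2 : ℂ)‖ₑ = ‖collisionWeight γ b₀ q.1 q.2‖ₑ := by
    rw [← ofReal_norm, ← ofReal_norm, Complex.norm_real]
  simp_rw [gammaIntegrand, mul_assoc, sub_mul]
  rw [integral_const_mul, integral_sub i1 i2, enorm_mul, hc]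
  refine mul_le_mul_right (enorm_sub_le.trans ((add_le_add e1 e2).trans ?_)) _
  rw [← add_mul, ← mul_assoc, ← mul_assoc]
  gcongr
  exact gain_add_loss_le hβ q.1 q.2.1 q.2.2 _

/-- The dyadic blocks of `Γ(f, g)(·, v)` decay in `v` like `⟨v⟩^{γ - β}`, which is square integrable
exactly under the assumption on `β`. -/
lemma ae_blockNorm_Gamma_le {L : LittlewoodPaley d} {s β γ : ℝ} {b₀ : ℝ → ℝ}
    (hb_meas : Measurable b₀) {C : ℝ≥0∞} (hC : C < ∞)
    (hCw : ∀ v : Space d, ∫⁻ p, ‖collisionWeight γ b₀ v p‖ₑ ∂(collisionMeasure d) ≤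
      C * ENNReal.ofReal (bracket v ^ γ))
    {f g : Space d → Space d → ℂ} (hf : L.MemLinfty s β f) (hg : L.MemLinfty s β g)
    (hs : (d : ℝ) / 2 ≤ s) (hβ : 0 ≤ β) :
    ∀ᵐ v, ∀ n : ℕ, L.blockNorm ((n : ℤ) - 1) (fun x => Gamma γ b₀ f g x v) ≤
      2 * C * productBound d n (L.supBlock β f) (L.supBlock β g) *
        ENNReal.ofReal (bracket v ^ (γ - β)) := by
  have hrot := measurePreserving_prodRotate (d := d)
  have hm := ((aestronglyMeasurable_gammaIntegrand γ hb_meas hf.1 hg.1).comp_measurePreserving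
    hrot).prodMk_left
  have hbd := Measure.ae_ae_of_ae_prod (hrot.quasiMeasurePreserving.ae
    (ae_enorm_gammaIntegrand_le γ b₀ hf hg hs hβ))
  have hblock := Measure.ae_ae_of_ae_prod
    (ae_enorm_integral_gammaIntegrand_mul_le γ b₀ hf hg hs hβ)
  filter_upwards [hm, hbd, hblock] with v hv1 hv2 hv3 n
  have hwm : Measurable fun p => ‖collisionWeight γ b₀ v p‖ₑ :=
    ((measurable_collisionWeight γ hb_meas).comp measurable_prodMk_left).enorm
  have hbv := bracket_pos v
  simp_rw [Gamma_eq_integral]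
  have hR : 2 * ENNReal.ofReal (bracket v ^ (-β)) * (L.supBound β f * L.supBound β g) < ∞ :=
    ENNReal.mul_lt_top (ENNReal.mul_lt_top (ENNReal.ofNat_lt_top (n := 2)) ENNReal.ofReal_lt_top)
      (ENNReal.mul_lt_top (hf.supBound_lt_top hs) (hg.supBound_lt_top hs))
  refine (L.blockNorm_integral_le (k := fun x p => gammaIntegrand γ b₀ f g x v p) hv1
    (hwm.mul_const _).aemeasurable (lintegral_gamma_bound_lt_top hC hCw v hR) hv2 n
    (hv3.mono fun p hp => hp n)).trans ?_
  rw [lintegral_mul_const _ hwm]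
  calc _ ≤ C * ENNReal.ofReal (bracket v ^ γ) * (2 * ENNReal.ofReal (bracket v ^ (-β)) *
        productBound d n (L.supBlock β f) (L.supBlock β g)) := by gcongr; exact hCw v
    _ = 2 * C * productBound d n (L.supBlock β f) (L.supBlock β g) *
        (ENNReal.ofReal (bracket v ^ γ) * ENNReal.ofReal (bracket v ^ (-β))) := by ring
    _ = _ := by
        rw [← ENNReal.ofReal_mul (by positivity), ← Real.rpow_add hbv, sub_eq_add_neg]

lemma exists_normL2_Gamma_le (hd : 1 ≤ d) (L : LittlewoodPaley d) {s β γ : ℝ} {b₀ : ℝ → ℝ}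
    (hγ : -(d : ℝ) < γ) (hb_meas : Measurable b₀)
    (hb : ∃ C₀ : ℝ, ∀ c ∈ Set.Icc (-1 : ℝ) 1, 0 ≤ b₀ c ∧ b₀ c ≤ C₀ * |c|)
    (hs : (d : ℝ) / 2 ≤ s) (hβ : γ + (d : ℝ) / 2 < β) (hβ0 : 0 ≤ β) :
    ∃ C : ℝ≥0∞, C < ∞ ∧ ∀ f g : Space d → Space d → ℂ,
      L.MemLinfty s β f → L.MemLinfty s β g →
        L.normL2 s (Gamma γ b₀ f g) ≤ C * L.normLinfty s β f * L.normLinfty s β g := by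
  have hs0 : 0 < s := by
    have : (1 : ℝ) ≤ d := by exact_mod_cast hd
    linarith
  obtain ⟨C, hC, hCw⟩ := exists_lintegral_collisionWeight_le hd hγ hb
  obtain ⟨C', hC', hprod⟩ := exists_dyadicSum_le hs hs0
  set I : ℝ≥0∞ := ∫⁻ v : Space d, ENNReal.ofReal (bracket v ^ (γ - β)) ^ (2 : ℝ) with hI
  have hIt : I < ∞ := lintegral_bracket_rpow_sq_lt_top hβ
  have hIm : Measurable fun v : Space d => ENNReal.ofReal (bracket v ^ (γ - β)) ^ (2 : ℝ) :=
    (continuous_bracket.measurable.pow_const _).ennreal_ofReal.pow_const _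
  refine ⟨C' * (2 * C * I ^ (1 / 2 : ℝ)), ENNReal.mul_lt_top hC' (ENNReal.mul_lt_top
    (ENNReal.mul_lt_top (ENNReal.ofNat_lt_top (n := 2)) hC)
    (ENNReal.rpow_lt_top_of_nonneg (by norm_num) hIt.ne)), fun f g hf hg => ?_⟩
  -- the bound for the blocks is a function of `n` times a function of `v`, so its `L²_v` norm
  -- factors
  refine hprod _ _ _ _ fun n => ?_
  set P : ℝ≥0∞ := productBound d n (L.supBlock β f) (L.supBlock β g)
  calc _ ≤ (∫⁻ v : Space d, (2 * C * P * ENNReal.ofReal (bracket v ^ (γ - β))) ^ (2 : ℝ)) ^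
          (1 / 2 : ℝ) := by
        gcongr ?_ ^ _
        refine lintegral_mono_ae ?_
        filter_upwards [ae_blockNorm_Gamma_le hb_meas hC hCw hf hg hs hβ0] with v hv
        gcongr
        exact hv n
    _ = ((2 * C * P) ^ (2 : ℝ) * I) ^ (1 / 2 : ℝ) := by
        simp_rw [ENNReal.mul_rpow_of_nonneg _ _ (zero_le_two : (0 : ℝ) ≤ 2)]
        rw [lintegral_const_mul _ hIm]
    _ = 2 * C * P * I ^ (1 / 2 : ℝ) := by
        rw [ENNReal.mul_rpow_of_nonneg _ _ (by norm_num), ← ENNReal.rpow_mul]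
        norm_num
    _ = 2 * C * I ^ (1 / 2 : ℝ) * P := by ring

end Boltzmann

theorem corollary3p1 (d : ℕ) (hd : 1 ≤ d) (L : Boltzmann.LittlewoodPaley d)
    (γ : ℝ) (hγ : -(d : ℝ) < γ) (hγ' : γ ≤ 1)
    (b₀ : ℝ → ℝ) (hb_meas : Measurable b₀)
    (hb : ∃ C₀ : ℝ, ∀ c ∈ Set.Icc (-1 : ℝ) 1, 0 ≤ b₀ c ∧ b₀ c ≤ C₀ * |c|)
    (s β : ℝ) (hs : (d : ℝ) / 2 ≤ s) (hβ : γ + (d : ℝ) / 2 < β) (hβ0 : 0 ≤ β) :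
    ∃ C : ℝ, 0 < C ∧ ∀ f g : Boltzmann.Space d → Boltzmann.Space d → ℂ,
      L.MemLinfty s β f → L.MemLinfty s β g →
        Boltzmann.GammaConverges γ b₀ f g ∧
        L.MemL2 s (Boltzmann.Gamma γ b₀ f g) ∧
        L.normL2 s (Boltzmann.Gamma γ b₀ f g) ≤
          ENNReal.ofReal C * L.normLinfty s β f * L.normLinfty s β g := by
  obtain ⟨C, hC, h⟩ := Boltzmann.exists_normL2_Gamma_le hd L hγ hb_meas hb hs hβ hβ0
  refine ⟨C.toReal + 1, by positivity, fun f g hf hg =>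
    ⟨Boltzmann.gammaConverges hd hγ hb_meas hb hf hg hs hβ0,
      ⟨Boltzmann.aestronglyMeasurable_Gamma γ hb_meas hf.1 hg.1, (h f g hf hg).trans_lt
        (ENNReal.mul_lt_top (ENNReal.mul_lt_top hC hf.2) hg.2)⟩, (h f g hf hg).trans ?_⟩⟩
  gcongr
  rw [ENNReal.le_ofReal_iff_toReal_le hC.ne (by positivity)]
  linarith

end
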